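/- Theorem 4.1. An $\mathbb{F}_1$-scheme is a topological space with a sheaf of commutative monoids that is locally isomorphic to spectra $\operatorname{spec} A$ of commutative monoids $A$. It is integral if the monoid $A$ of every affine open subset $\operatorname{spec} A$ is cancellative, and of finite type if it has a finite covering by affine schemes $\operatorname{spec} A_i$ with finitely generated monoids $A_i$. Its complex base change $X_{\mathbb{C}}$ is the scheme over $\mathbb{C}$ glued from the schemes $\operatorname{Spec}\mathbb{C}[A]$, where $\operatorname{spec} A$ runs through the affine open subsets of $X$. For a commutative monoid $A$, the comultiplication $a\mapsto a\otimes a$ makes $\operatorname{Spec}\mathbb{C}[A]$ a monoid scheme, and a group scheme if $A$ is a group; $\mathrm{GL}_1^r=\operatorname{Spec}\mathbb{C}[\mathbb{Z}^r]$. A toric variety is an integral scheme of finite type over $\mathbb{C}$ (separatedness is not required) with an action of a torus $\mathrm{GL}_1^r$ for which the orbit of some $\mathbb{C}$-point is open. Let $X$ be a connected (in particular non-empty) integral $\mathbb{F}_1$-scheme of finite type. Then $X$ has a generic point $\eta$. For every affine open subset $\operatorname{spec} A$ of $X$, the canonical map $\varphi\colon A\to G:=\mathcal{O}_{X,\eta}$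 is injective and every element of $G$ is a quotient of images of elements of $A$, so that $G$ is the quotient group of $A$. There is an action of the group scheme $\mathcal{G}=\operatorname{Spec}\mathbb{C}[G]$ on $X_{\mathbb{C}}$ that is given by $a\mapsto\varphi(a)\otimes a$ on each chart $\operatorname{Spec}\mathbb{C}[A]$. There are an integer $r\ge 0$, a finite abelian group $F$ and an isomorphism $G\cong\mathbb{Z}^r\times F$. Let $\mathrm{GL}_1^r\to\mathcal{G}$ and $\operatorname{Spec}\mathbb{C}[F]\to\mathcal{G}$ be the homomorphisms induced by the two projections of $G\cong\mathbb{Z}^r\times F$, and give every irreducible component of $X_{\mathbb{C}}$ its reduced scheme structure. Then the following hold. 1. Every irreducible component $Z$ of $X_{\mathbb{C}}$ has an action of $\mathrm{GL}_1^r$ for which the inclusion $Z\to X_{\mathbb{C}}$ is equivariant along $\mathrm{GL}_1^r\to\mathcal{G}$, and with this action $Z$ is a toric variety. 2. For any two irreducible components $Z$, $Z'$ of $X_{\mathbb{C}}$ there is a $\mathbb{C}$-point of $\operatorname{Spec}\mathbb{C}[F]$ whose translation on $X_{\mathbb{C}}$ restricts to a $\mathrm{GL}_1^r$-equivariant isomorphism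 $Z\cong Z'$ over $\mathbb{C}$. In particular, all irreducible components of $X_{\mathbb{C}}$ are isomorphic to each other as toric varieties. -/

import Mathlib

open CategoryTheory MonoidalCategory TopologicalSpace Opposite AlgebraicGeometry

universe u

noncomputable section

namespace FOne

/-- The prime ideals of a commutative monoid `A`: subsets `𝔭` with `A𝔭 ⊆ 𝔭` whose complement is a
submonoid. The empty set is always one of them. -/
@[ext]
structure MonoidSpectrum (A : Type u) [CommMonoid A] where
  /-- the underlying set -/
  asSet : Set A
  mul_mem : ∀ (a : A) {x : A}, x ∈ asSet → a * x ∈ asSet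
  one_notMem : (1 : A) ∉ asSet
  mem_or_mem : ∀ {a b : A}, a * b ∈ asSet → a ∈ asSet ∨ b ∈ asSet

namespace MonoidSpectrum

variable {A B : Type u} [CommMonoid A] [CommMonoid B]

/-- The submonoid `A \ 𝔭`. -/
def compl (p : MonoidSpectrum A) : Submonoid A where
  carrier := p.asSetᶜ
  one_mem' := p.one_notMem
  mul_mem' ha hb h := (p.mem_or_mem h).elim ha hb

/-- The set `D(f)` of all prime ideals that do not contain `f`. -/
def basicOpenSet (f : A) : Set (MonoidSpectrum A) := {p | f ∈ p.compl}

/-- The Zariski topology: the closed sets are the `V(I) = {𝔭 | I ⊆ 𝔭}`, that is, the open sets are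
the unions of sets `D(f)`. -/
instance : TopologicalSpace (MonoidSpectrum A) where
  IsOpen U := ∃ I : Set A, U = {p | ¬ I ⊆ p.asSet}
  isOpen_univ := ⟨{1}, by ext p; simp [p.one_notMem]⟩
  isOpen_inter := by
    rintro _ _ ⟨I, rfl⟩ ⟨J, rfl⟩
    refine ⟨{x | ∃ a ∈ I, ∃ b ∈ J, x = a * b}, ?_⟩
    ext p
    simp only [Set.mem_inter_iff, Set.mem_ofPred_eq, Set.not_subset]
    constructor
    · rintro ⟨⟨a, ha, ha'⟩, b, hb, hb'⟩
      exact ⟨a * b, ⟨a, ha, b, hb, rfl⟩, fun h => (p.mem_or_mem h).elim ha' hb'⟩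
    · rintro ⟨_, ⟨a, ha, b, hb, rfl⟩, h⟩
      exact ⟨⟨a, ha, fun h' => h (by rw [mul_comm]; exact p.mul_mem b h')⟩,
        b, hb, fun h' => h (p.mul_mem a h')⟩
  isOpen_sUnion := by
    intro S hS
    choose! I hI using hS
    refine ⟨⋃ s ∈ S, I s, ?_⟩
    ext p
    simp only [Set.mem_sUnion, Set.mem_ofPred_eq, Set.iUnion_subset_iff, not_forall]
    constructor
    · rintro ⟨s, hs, hp⟩
      rw [hI s hs] at hp
      exact ⟨s, hs, hp⟩
    · rintro ⟨s, hs, hp⟩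
      refine ⟨s, hs, ?_⟩
      rw [hI s hs]
      exact hp

theorem isOpen_iff (U : Set (MonoidSpectrum A)) :
    IsOpen U ↔ ∃ I : Set A, U = {p | ¬ I ⊆ p.asSet} := Iff.rfl

/-- The basic open set `D(f)`. -/
def basicOpen (f : A) : Opens (MonoidSpectrum A) where
  carrier := basicOpenSet f
  is_open' := ⟨{f}, by ext p; simp [basicOpenSet, compl]⟩

theorem mem_basicOpen {f : A} {p : MonoidSpectrum A} : p ∈ basicOpen f ↔ f ∈ p.compl := Iff.rfl

theorem exists_basicOpen_le {U : Opens (MonoidSpectrum A)} {p : MonoidSpectrum A} (hp : p ∈ U) :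
    ∃ f, p ∈ basicOpen f ∧ basicOpen f ≤ U := by
  obtain ⟨I, hI⟩ := U.2
  have hp' : p ∈ U.1 := hp
  rw [hI] at hp'
  obtain ⟨f, hf, hfp⟩ := Set.not_subset.mp hp'
  refine ⟨f, hfp, fun q hq => ?_⟩
  have : q ∈ U.1 := by
    rw [hI]
    exact fun h => hq (h hf)
  exact this

/-- The continuous map `𝔮 ↦ φ⁻¹(𝔮)`. -/
def comap (φ : A →* B) (q : MonoidSpectrum B) : MonoidSpectrum A where
  asSet := φ ⁻¹' q.asSet
  mul_mem a x hx := by simpa using q.mul_mem (φ a) hx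
  one_notMem := by simpa using q.one_notMem
  mem_or_mem h := q.mem_or_mem (by simpa using h)

theorem continuous_comap (φ : A →* B) : Continuous (comap φ) := by
  refine ⟨?_⟩
  rintro _ ⟨I, rfl⟩
  refine ⟨φ '' I, ?_⟩
  ext q
  simp [comap]

variable (A) in
/-- `spec A` as a topological space. -/
abbrev top : TopCat.{u} := TopCat.of (MonoidSpectrum A)

/-- The localization `A_𝔭` at a prime ideal. -/
abbrev Loc (p : top A) : Type u := Localization (compl p)

variable (A) in
/-- Functions that are given on the whole open set by one fraction `a / s`. -/
def isFractionPrelocal : TopCat.PrelocalPredicate (Loc (A := A)) where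
  pred {U} f := ∃ a s : A, ∀ x : U, ∃ hs : s ∈ compl x.1, f x = Localization.mk a ⟨s, hs⟩
  res := by
    rintro V U i f ⟨a, s, w⟩
    exact ⟨a, s, fun x => w ⟨x.1, i.le x.2⟩⟩

variable (A) in
/-- Functions that are locally fractions. -/
def isLocallyFraction : TopCat.LocalPredicate (Loc (A := A)) :=
  (isFractionPrelocal A).sheafify

/-- The sections over `U` of the structure sheaf: the functions `s` on `U` with `s(𝔭) ∈ A_𝔭` which
are locally of the form `a / s` with `a, s ∈ A`. -/
def sections (U : Opens (top A)) : Submonoid (Π x : U, Loc x.1) where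
  carrier := {f | (isLocallyFraction A).pred f}
  one_mem' x := ⟨U, x.2, 𝟙 _, 1, 1, fun y =>
    ⟨y.1.compl.one_mem, (Localization.mk_one).symm⟩⟩
  mul_mem' {a b} ha hb x := by
    obtain ⟨Va, ma, ia, ra, sa, wa⟩ := ha x
    obtain ⟨Vb, mb, ib, rb, sb, wb⟩ := hb x
    refine ⟨Va ⊓ Vb, ⟨ma, mb⟩, Opens.infLELeft _ _ ≫ ia, ra * rb, sa * sb, fun x ↦ ?_⟩
    obtain ⟨hsax, hsa⟩ := wa ⟨x.1, x.2.1⟩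
    obtain ⟨hsbx, hsb⟩ := wb ⟨x.1, x.2.2⟩
    exact ⟨x.1.compl.mul_mem hsax hsbx,
      congr($hsa * $hsb).trans (Localization.mk_mul ..)⟩

variable (A) in
/-- The structure sheaf of `spec A` as a presheaf of monoids. -/
def structurePresheaf : TopCat.Presheaf CommMonCat.{u} (top A) where
  obj U := CommMonCat.of (sections U.unop)
  map i := CommMonCat.ofHom
    { toFun := fun s => ⟨fun x => s.1 ⟨x.1, i.unop.le x.2⟩, (isLocallyFraction A).res i.unop s.1 s.2⟩
      map_one' := rfl
      map_mul' := fun _ _ => rfl }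

theorem isSheaf_structurePresheaf : (structurePresheaf A).IsSheaf := by
  rw [TopCat.Presheaf.isSheaf_iff_isSheaf_comp (forget CommMonCat.{u})]
  exact TopCat.Presheaf.isSheaf_of_iso
    (NatIso.ofComponents (fun _ => Iso.refl _) : (TopCat.subsheafToTypes (isLocallyFraction A)).1 ≅
      structurePresheaf A ⋙ forget CommMonCat.{u})
    (TopCat.subsheafToTypes (isLocallyFraction A)).2

end MonoidSpectrum

/-- The affine scheme `spec A` over `𝔽₁`. -/
def spec (A : CommMonCat.{u}) : SheafedSpace CommMonCat.{u} where
  carrier := MonoidSpectrum.top A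
  presheaf := MonoidSpectrum.structurePresheaf A
  IsSheaf := MonoidSpectrum.isSheaf_structurePresheaf

namespace MonoidSpectrum

variable {A B : Type u} [CommMonoid A] [CommMonoid B]

/-- The homomorphism `A_{φ⁻¹(𝔮)} → B_𝔮`. -/
def locMap (φ : A →* B) (q : top B) : Loc (A := A) (comap φ q) →* Loc q :=
  (Localization.monoidOf (compl (comap φ q))).map (T := compl q) (g := φ)
    (fun y => show φ y ∈ compl q from y.2)
    (Localization.monoidOf (compl q))

theorem locMap_mk (φ : A →* B) (q : top B) (a s : A) (hs : s ∈ compl (comap φ q)) :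
    locMap φ q (Localization.mk a ⟨s, hs⟩) = Localization.mk (φ a) ⟨φ s, hs⟩ := by
  rw [Localization.mk_eq_monoidOf_mk'_apply, locMap, Submonoid.LocalizationMap.map_mk',
    Localization.mk_eq_monoidOf_mk'_apply]

end MonoidSpectrum

open MonoidSpectrum in
/-- The morphism `spec B ⟶ spec A` induced by `φ : A → B`. -/
def specMap {A B : CommMonCat.{u}} (φ : A ⟶ B) : spec B ⟶ spec A :=
  InducedCategory.homMk
    { base := TopCat.ofHom ⟨comap φ.hom, continuous_comap φ.hom⟩
      c :=
        { app := fun U => CommMonCat.ofHom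
            { toFun := fun s => ⟨fun q => locMap φ.hom q.1 (s.1 ⟨comap φ.hom q.1, q.2⟩), by
                rintro ⟨q, hq⟩
                obtain ⟨V, hV, i, a, t, h⟩ := s.2 ⟨comap φ.hom q, hq⟩
                refine ⟨(Opens.map (TopCat.ofHom ⟨comap φ.hom, continuous_comap φ.hom⟩)).obj V,
                  hV, (Opens.map _).map i, φ.hom a, φ.hom t, ?_⟩
                rintro ⟨y, hy⟩
                obtain ⟨ht, h⟩ := h ⟨comap φ.hom y, hy⟩
                exact ⟨ht, (congrArg (locMap φ.hom y) h).trans (locMap_mk ..)⟩⟩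
              map_one' := by
                apply Subtype.ext
                funext q
                exact map_one (locMap φ.hom q.1)
              map_mul' := fun s t => by
                apply Subtype.ext
                funext q
                exact map_mul (locMap φ.hom q.1) _ _ }
          naturality := fun _ _ _ => rfl } }

namespace MonoidSpectrum

section Localization

variable {A B : Type u} [CommMonoid A] [CommMonoid B] {φ : A →* B} {f : A}

theorem mem_compl_of_isUnit {q : MonoidSpectrum B} {b : B} (hb : IsUnit b) : b ∈ q.compl := by
  obtain ⟨c, hc⟩ := hb.exists_left_inv
  intro h
  exact q.one_notMem (hc ▸ q.mul_mem c h)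

theorem mul_mem_compl {q : MonoidSpectrum B} {a b : B} :
    a * b ∈ q.compl ↔ a ∈ q.compl ∧ b ∈ q.compl := by
  refine ⟨fun h => ⟨fun ha => h ?_, fun hb => h (q.mul_mem a hb)⟩, fun h => q.compl.mul_mem h.1 h.2⟩
  rw [mul_comm]
  exact q.mul_mem b ha

theorem comap_injective (h : (Submonoid.powers f).IsLocalizationMap φ) :
    Function.Injective (comap φ) := by
  intro q q' hqq
  have key : ∀ (q : MonoidSpectrum B) (b : B) (x : A × Submonoid.powers f), b * φ x.2 = φ x.1 →
      (b ∈ q.compl ↔ x.1 ∈ (comap φ q).compl) := by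
    intro q b x hx
    change _ ↔ φ x.1 ∈ q.compl
    rw [← hx, mul_mem_compl]
    exact ⟨fun hb => ⟨hb, mem_compl_of_isUnit (h.map_units x.2)⟩, fun hb => hb.1⟩
  ext b
  obtain ⟨x, hx⟩ := h.surj b
  have h1 := key q b x hx
  have h2 := key q' b x hx
  rw [hqq] at h1
  exact not_iff_not.mp (h1.trans h2.symm)

theorem exists_comap_eq (h : (Submonoid.powers f).IsLocalizationMap φ) (p : MonoidSpectrum A)
    (hp : f ∈ p.compl) : ∃ q, comap φ q = p := by
  have hpow : ∀ s : Submonoid.powers f, (s : A) ∈ p.compl := by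
    rintro ⟨_, n, rfl⟩
    exact pow_mem hp n
  have key : ∀ a a' : A, φ a = φ a' → (a ∈ p.compl → a' ∈ p.compl) := by
    intro a a' haa ha
    obtain ⟨c, hc⟩ := h.exists_of_eq haa
    exact (mul_mem_compl.mp (hc ▸ p.compl.mul_mem (hpow c) ha)).2
  let S : Set B := {b | ∃ x : A × Submonoid.powers f, b * φ x.2 = φ x.1 ∧ x.1 ∈ p.compl}
  have hS : ∀ (b : B) (x : A × Submonoid.powers f), b * φ x.2 = φ x.1 →
      (b ∈ S ↔ x.1 ∈ p.compl) := by
    intro b x hx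
    refine ⟨?_, fun hx' => ⟨x, hx, hx'⟩⟩
    rintro ⟨y, hy, hy'⟩
    have := key (y.1 * x.2) (x.1 * y.2) (by
      rw [map_mul, map_mul, ← hx, ← hy, mul_assoc, mul_assoc, mul_comm (φ y.2)])
      (p.compl.mul_mem hy' (hpow _))
    exact (mul_mem_compl.mp this).1
  have hmul : ∀ b c : B, b * c ∈ S ↔ b ∈ S ∧ c ∈ S := by
    intro b c
    obtain ⟨x, hx⟩ := h.surj b
    obtain ⟨y, hy⟩ := h.surj c
    rw [hS b x hx, hS c y hy, hS (b * c) (x * y) (by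
      simp only [Prod.fst_mul, Prod.snd_mul, Submonoid.coe_mul, map_mul]
      rw [mul_mul_mul_comm, hx, hy])]
    exact mul_mem_compl
  refine ⟨⟨Sᶜ, fun a x hx hax => hx ((hmul a x).mp hax).2, ?_, ?_⟩, ?_⟩
  · have : (1 : B) ∈ S := ⟨(1, 1), by simp, p.compl.one_mem⟩
    exact fun h => h this
  · intro a b hab
    by_contra! hcon
    simp only [Set.mem_compl_iff, not_not] at hcon
    exact hab ((hmul a b).mpr hcon)
  · ext a
    have h1 : φ a ∈ S ↔ a ∈ p.compl := hS (φ a) (a, 1) (by simp)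
    change ¬ (φ a ∈ S) ↔ _
    rw [h1]
    exact not_not

theorem range_comap (h : (Submonoid.powers f).IsLocalizationMap φ) :
    Set.range (comap φ) = basicOpen f := by
  ext p
  constructor
  · rintro ⟨q, rfl⟩
    exact mem_compl_of_isUnit (q := q) (h.map_units ⟨f, Submonoid.mem_powers f⟩)
  · exact exists_comap_eq h p

theorem isOpenEmbedding_comap (h : (Submonoid.powers f).IsLocalizationMap φ) :
    Topology.IsOpenEmbedding (comap φ) where
  injective := comap_injective h
  isOpen_range := by
    rw [range_comap h]
    exact (basicOpen f).2
  eq_induced := by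
    apply TopologicalSpace.ext_iff.mpr
    intro U
    rw [isOpen_induced_iff]
    constructor
    · rintro ⟨J, rfl⟩
      refine ⟨{p | ¬ {a | ∃ b ∈ J, ∃ s ∈ Submonoid.powers f, b * φ s = φ a} ⊆ p.asSet},
        ⟨_, rfl⟩, ?_⟩
      ext q
      simp only [Set.preimage, Set.mem_ofPred_eq, Set.not_subset]
      constructor
      · rintro ⟨a, ⟨b, hb, s, hs, hbs⟩, ha⟩
        refine ⟨b, hb, ?_⟩
        have : b * φ s ∈ q.compl := hbs ▸ ha
        exact (mul_mem_compl.mp this).1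
      · rintro ⟨b, hb, hbq⟩
        obtain ⟨x, hx⟩ := h.surj b
        refine ⟨x.1, ⟨b, hb, x.2, x.2.2, hx⟩, ?_⟩
        have : b * φ x.2 ∈ q.compl :=
          q.compl.mul_mem hbq (mem_compl_of_isUnit (h.map_units x.2))
        rw [hx] at this
        exact this
    · rintro ⟨V, hV, rfl⟩
      exact hV.preimage (continuous_comap φ)

theorem locMap_injective (h : (Submonoid.powers f).IsLocalizationMap φ) (q : top B) :
    Function.Injective (locMap φ q) := by
  intro x y
  induction x using Localization.induction_on with | _ x
  induction y using Localization.induction_on with | _ y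
  obtain ⟨a, s, hs⟩ := x
  obtain ⟨a', s', hs'⟩ := y
  rw [locMap_mk, locMap_mk, Localization.mk_eq_mk_iff, Localization.mk_eq_mk_iff,
    Localization.r_iff_exists, Localization.r_iff_exists]
  rintro ⟨⟨c, hc⟩, hcc⟩
  obtain ⟨⟨d, t⟩, hd⟩ := h.surj c
  have hd' : φ d ∈ compl q := by
    rw [← hd]
    exact (compl q).mul_mem hc (mem_compl_of_isUnit (h.map_units t))
  dsimp only at hcc hd
  have : φ (d * (s' * a)) = φ (d * (s * a')) := by
    simp only [map_mul, ← hd]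
    calc c * φ t * (φ s' * φ a) = φ t * (c * (φ s' * φ a)) := by ac_rfl
      _ = φ t * (c * (φ s * φ a')) := by rw [hcc]
      _ = _ := by ac_rfl
  obtain ⟨e, he⟩ := h.exists_of_eq this
  refine ⟨⟨e * d, ?_⟩, ?_⟩
  · refine Submonoid.mul_mem _ ?_ hd'
    exact mem_compl_of_isUnit (q := q) (h.map_units e)
  · simpa [mul_assoc] using he

/-- Every fraction over `B` comes from a fraction over `A`. -/
theorem exists_fraction (h : (Submonoid.powers f).IsLocalizationMap φ) (b t : B) :
    ∃ a s : A, ∀ (q : top B) (ht : t ∈ compl q), ∃ hs : s ∈ compl (comap φ q),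
      locMap φ q (Localization.mk a ⟨s, hs⟩) = Localization.mk b ⟨t, ht⟩ := by
  obtain ⟨⟨a, m⟩, ha⟩ := h.surj b
  obtain ⟨⟨c, n⟩, hc⟩ := h.surj t
  dsimp only at ha hc
  refine ⟨a * n, c * m, fun q ht => ?_⟩
  have hs : c * m ∈ compl (comap φ q) := by
    change φ (c * m) ∈ compl q
    rw [map_mul, ← hc]
    exact (compl q).mul_mem ((compl q).mul_mem ht (mem_compl_of_isUnit (h.map_units n)))
      (mem_compl_of_isUnit (h.map_units m))
  refine ⟨hs, ?_⟩
  rw [locMap_mk, Localization.mk_eq_mk_iff, Localization.r_iff_exists]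
  refine ⟨1, ?_⟩
  simp only [map_mul, ← ha, ← hc]
  ac_rfl

end Localization

end MonoidSpectrum

open MonoidSpectrum in
theorem isOpenEmbedding_specMap {A B : CommMonCat.{u}} (φ : A ⟶ B) (f : A)
    (h : (Submonoid.powers f).IsLocalizationMap φ.hom) :
    Topology.IsOpenEmbedding (specMap φ).hom.base := isOpenEmbedding_comap h

open MonoidSpectrum in
theorem isOpenImmersion_specMap {A B : CommMonCat.{u}} (φ : A ⟶ B) (f : A)
    (h : (Submonoid.powers f).IsLocalizationMap φ.hom) :
    SheafedSpace.IsOpenImmersion (specMap φ) where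
  base_open := isOpenEmbedding_specMap φ f h
  c_iso V := by
    rw [ConcreteCategory.isIso_iff_bijective]
    set W := (isOpenEmbedding_specMap φ f h).functor.obj V with hW
    have hWr : ∀ p : W, ∃ q : V, comap φ.hom q.1 = p.1 := by
      rintro ⟨p, q, hq, hqp⟩
      exact ⟨⟨q, hq⟩, hqp⟩
    have hVW : ∀ q : top B, comap φ.hom q ∈ W ↔ q ∈ V := by
      intro q
      constructor
      · rintro ⟨q', hq', hqq⟩
        exact comap_injective h hqq ▸ hq'
      · exact fun hq => ⟨q, hq, rfl⟩
    constructor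
    · intro s t hst
      apply Subtype.ext
      funext p
      obtain ⟨p, hp⟩ := p
      obtain ⟨⟨q, hq⟩, hqp⟩ := hWr ⟨p, hp⟩
      dsimp only at hqp
      subst hqp
      apply locMap_injective h q
      exact congrFun (congrArg Subtype.val hst) ⟨q, hp⟩
    · intro u
      have hu : ∀ q : V, ∃ z : Loc (comap φ.hom q.1),
          locMap φ.hom q.1 z = u.1 ⟨q.1, (hVW q.1).mpr q.2⟩ := by
        intro q
        obtain ⟨O, hO, i, b, t, hbt⟩ := u.2 ⟨q.1, (hVW q.1).mpr q.2⟩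
        obtain ⟨a, s, has⟩ := exists_fraction h b t
        obtain ⟨ht, hu⟩ := hbt ⟨q.1, hO⟩
        obtain ⟨hs, hh⟩ := has q.1 ht
        exact ⟨_, hh.trans hu.symm⟩
      have hz : ∀ p : W, ∃ z : Loc p.1, ∀ (q : V) (hq : comap φ.hom q.1 = p.1),
          locMap φ.hom q.1 (hq ▸ z) = u.1 ⟨q.1, (hVW q.1).mpr q.2⟩ := by
        rintro ⟨p, hp⟩
        obtain ⟨q, hqp⟩ := hWr ⟨p, hp⟩
        dsimp only at hqp
        subst hqp
        obtain ⟨z, hz⟩ := hu q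
        refine ⟨z, ?_⟩
        rintro q' hq'
        obtain rfl : q' = q := Subtype.ext (comap_injective h hq')
        exact hz
      choose z hz using hz
      have hz' : ∀ (q : V) (hq : comap φ.hom q.1 ∈ W),
          locMap φ.hom q.1 (z ⟨_, hq⟩) = u.1 ⟨q.1, hq⟩ := fun q hq => hz ⟨_, hq⟩ q rfl
      refine ⟨⟨z, ?_⟩, ?_⟩
      · intro p
        obtain ⟨p, hp⟩ := p
        obtain ⟨q, hqp⟩ := hWr ⟨p, hp⟩
        dsimp only at hqp
        subst hqp
        obtain ⟨O, hO, i, b, t, hbt⟩ := u.2 ⟨q.1, hp⟩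
        obtain ⟨a, s, has⟩ := exists_fraction h b t
        refine ⟨(isOpenEmbedding_specMap φ f h).functor.obj O, ⟨q.1, hO, rfl⟩, homOfLE ?_, a, s, ?_⟩
        · rintro _ ⟨y, hy, rfl⟩
          exact i.le hy
        · rintro ⟨_, y, hy, rfl⟩
          obtain ⟨ht, hu⟩ := hbt ⟨y, hy⟩
          obtain ⟨hs, hh⟩ := has y ht
          refine ⟨hs, locMap_injective h y ?_⟩
          have hyW : comap φ.hom y ∈ W := i.le hy
          exact ((hz' ⟨y, (hVW y).mp hyW⟩ hyW).trans hu).trans hh.symm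
      · apply Subtype.ext
        funext q
        exact hz' ⟨q.1, (hVW q.1).mp q.2⟩ q.2
namespace MonoidSpectrum

variable {A : Type u} [CommMonoid A]

/-- The section `a / 1` of the structure sheaf. -/
def const (a : A) (U : Opens (top A)) : sections U :=
  ⟨fun _ => Localization.mk a 1, fun x => ⟨U, x.2, 𝟙 _, a, 1, fun y =>
    ⟨y.1.compl.one_mem, rfl⟩⟩⟩

/-- The largest prime ideal that does not contain `f`. -/
def away (f : A) : MonoidSpectrum A where
  asSet := {a | ∀ n : ℕ, ¬ a ∣ f ^ n}
  mul_mem a x hx n h := hx n ((Dvd.intro_left a rfl).trans h)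
  one_notMem h := h 0 (one_dvd _)
  mem_or_mem := by
    intro a b hab
    by_contra! hcon
    simp only [Set.mem_ofPred_eq, not_forall, not_not] at hcon
    obtain ⟨⟨n, hn⟩, m, hm⟩ := hcon
    exact hab (n + m) (pow_add f n m ▸ mul_dvd_mul hn hm)

theorem mem_compl_away {f a : A} : a ∈ (away f).compl ↔ ∃ n : ℕ, a ∣ f ^ n := by
  change ¬ (∀ n : ℕ, ¬ a ∣ f ^ n) ↔ _
  simp

theorem away_mem_basicOpen (f : A) : away f ∈ basicOpen f :=
  mem_compl_away.mpr ⟨1, by simp⟩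

theorem basicOpen_le_of_away_mem {f : A} {U : Opens (MonoidSpectrum A)} (h : away f ∈ U) :
    basicOpen f ≤ U := by
  obtain ⟨g, hg, hgU⟩ := exists_basicOpen_le h
  refine le_trans (fun q hq => ?_) hgU
  obtain ⟨n, c, hc⟩ := mem_compl_away.mp (mem_basicOpen.mp hg)
  have : g * c ∈ q.compl := hc ▸ pow_mem (mem_basicOpen.mp hq) n
  exact (mul_mem_compl.mp this).1

theorem basicOpen_one : basicOpen (1 : A) = ⊤ :=
  top_le_iff.mp fun p _ => p.compl.one_mem

theorem exists_section_eq (f : A) (s : sections (A := A) (basicOpen f)) :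
    ∃ (a : A) (n : ℕ), s * const (f ^ n) _ = const a _ := by
  obtain ⟨O, hO, i, a, t, h⟩ := s.2 ⟨away f, away_mem_basicOpen f⟩
  have hle : basicOpen f ≤ O := basicOpen_le_of_away_mem hO
  obtain ⟨n, c, hc⟩ := mem_compl_away.mp (h ⟨away f, hO⟩).1
  refine ⟨a * c, n, ?_⟩
  apply Subtype.ext
  funext q
  obtain ⟨ht, hs⟩ := h ⟨q.1, hle q.2⟩
  change s.1 q * Localization.mk (f ^ n) 1 = Localization.mk (a * c) 1
  have hs' : s.1 q = Localization.mk a ⟨t, ht⟩ := hs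
  rw [hs', Localization.mk_mul, hc, Localization.mk_eq_mk_iff, Localization.r_iff_exists]
  refine ⟨1, ?_⟩
  simp only [Submonoid.coe_mul, Submonoid.coe_one]
  ac_rfl

theorem exists_of_const_eq {f a b : A} (h : const a (basicOpen f) = const b (basicOpen f)) :
    ∃ n : ℕ, f ^ n * a = f ^ n * b := by
  have := congrFun (congrArg Subtype.val h) ⟨away f, away_mem_basicOpen f⟩
  change Localization.mk a 1 = Localization.mk b 1 at this
  rw [Localization.mk_eq_mk_iff, Localization.r_iff_exists] at this
  obtain ⟨⟨c, hc⟩, h⟩ := this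
  simp only [Submonoid.coe_one, one_mul] at h
  obtain ⟨n, d, hd⟩ := mem_compl_away.mp hc
  refine ⟨n, ?_⟩
  rw [hd, mul_comm c d, mul_assoc, h, mul_assoc]

theorem const_mul (a b : A) (U : Opens (top A)) : const (a * b) U = const a U * const b U := by
  apply Subtype.ext
  funext q
  change Localization.mk (a * b) 1 = Localization.mk a 1 * Localization.mk b 1
  rw [Localization.mk_mul, one_mul]

theorem const_one (U : Opens (top A)) : const 1 U = 1 := by
  apply Subtype.ext
  funext q
  exact Localization.mk_one

theorem const_pow (a : A) (n : ℕ) (U : Opens (top A)) : const (a ^ n) U = const a U ^ n := by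
  induction n with
  | zero => simp [const_one]
  | succ n ih => rw [pow_succ, pow_succ, const_mul, ih]

theorem isUnit_const {f : A} {U : Opens (top A)} (h : U ≤ basicOpen f) : IsUnit (const f U) := by
  let g : sections U := ⟨fun q => Localization.mk 1 ⟨f, h q.2⟩, fun x => ⟨U, x.2, 𝟙 _, 1, f,
    fun y => ⟨h y.2, rfl⟩⟩⟩
  refine IsUnit.of_mul_eq_one g ?_
  apply Subtype.ext
  funext q
  change Localization.mk f 1 * Localization.mk 1 ⟨f, h q.2⟩ = 1
  rw [Localization.mk_mul, one_mul, mul_one]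
  exact Localization.mk_self_mk f _

theorem isLocalizationMap_basicOpen (f : A) {U V : Opens (top A)} (i : U ⟶ V)
    (hU : U = basicOpen f) (hV : V = ⊤) :
    (Submonoid.powers (const f V)).IsLocalizationMap
      ((structurePresheaf A).map i.op).hom := by
  subst hU
  obtain rfl : V = basicOpen 1 := hV.trans basicOpen_one.symm
  have hρ : ∀ a, ((structurePresheaf A).map i.op).hom (const a _) = const a (basicOpen f) :=
    fun a => rfl
  have hsurj : ∀ s : sections (A := A) (basicOpen 1), ∃ a, s = const a _ := by
    intro s
    obtain ⟨a, n, h⟩ := exists_section_eq 1 s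
    rw [one_pow, const_one, mul_one] at h
    exact ⟨a, h⟩
  refine ⟨?_, ?_, ?_⟩
  · rintro ⟨_, n, rfl⟩
    have h := (isUnit_const (le_refl (basicOpen f))).pow n
    exact (congrArg IsUnit (map_pow ((structurePresheaf A).map i.op).hom
      (const f (basicOpen 1)) n)).mpr h
  · intro z
    obtain ⟨a, n, h⟩ := exists_section_eq f z
    refine ⟨(const a _, ⟨const f _ ^ n, n, rfl⟩), ?_⟩
    change z * ((structurePresheaf A).map i.op).hom (const f _ ^ n) =
      ((structurePresheaf A).map i.op).hom (const a _)
    rw [← const_pow, hρ, hρ]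
    exact h
  · intro x y hxy
    obtain ⟨a, rfl⟩ := hsurj x
    obtain ⟨b, rfl⟩ := hsurj y
    obtain ⟨n, hn⟩ := exists_of_const_eq (f := f) hxy
    refine ⟨⟨const f _ ^ n, n, rfl⟩, ?_⟩
    change const f _ ^ n * const a _ = const f _ ^ n * const b _
    rw [← const_pow, ← const_mul, ← const_mul, hn]

end MonoidSpectrum

/-- A scheme over `𝔽₁`: a topological space with a sheaf of commutative monoids which is locally
isomorphic to spectra of monoids, that is, covered by open immersions from such spectra. -/
structure MonoidScheme extends SheafedSpace CommMonCat.{u} where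
  exists_chart : ∀ x : carrier, ∃ (A : CommMonCat.{u}) (j : spec A ⟶ toSheafedSpace),
    SheafedSpace.IsOpenImmersion j ∧ x ∈ Set.range j.hom.base

namespace MonoidScheme

variable (X : MonoidScheme.{u})

/-- An open subset `U` is affine if it is isomorphic to some `spec A`, that is, if it is the image
of an open immersion `spec A ⟶ X`. -/
def IsAffineOpen (U : Opens X.carrier) : Prop :=
  ∃ (A : CommMonCat.{u}) (j : spec A ⟶ X.toSheafedSpace),
    SheafedSpace.IsOpenImmersion j ∧ Set.range j.hom.base = U

/-- The partially ordered set of affine open subsets. -/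
abbrev AffineOpens : Type u := {U : Opens X.carrier // X.IsAffineOpen U}

/-- `X` is integral if the monoids of its affine open subsets have the cancellation property. -/
def IsIntegral : Prop :=
  ∀ (A : CommMonCat.{u}) (j : spec A ⟶ X.toSheafedSpace), SheafedSpace.IsOpenImmersion j →
    IsCancelMul A

/-- `X` is of finite type if it has a finite covering by affine schemes `spec A` with `A` finitely
generated. -/
def IsOfFiniteType : Prop :=
  ∃ (n : ℕ) (A : Fin n → CommMonCat.{u}) (j : ∀ i, spec (A i) ⟶ X.toSheafedSpace),
    (∀ i, Monoid.FG (A i) ∧ SheafedSpace.IsOpenImmersion (j i)) ∧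
    ∀ x : X.carrier, ∃ i, x ∈ Set.range (j i).hom.base

/-- The restriction homomorphism between the monoids of sections. -/
def res {U V : Opens X.carrier} (h : U ≤ V) :
    X.presheaf.obj (op V) →* X.presheaf.obj (op U) :=
  (X.presheaf.map (homOfLE h).op).hom

open MonoidSpectrum

variable {X}

/-- An affine open subset is the smallest open neighbourhood of one of its points. -/
theorem exists_focal {U : Opens X.carrier} (hU : X.IsAffineOpen U) :
    ∃ x ∈ U, ∀ W : Opens X.carrier, x ∈ W → U ≤ W := by
  obtain ⟨A, j, hj, hr⟩ := hU
  refine ⟨j.hom.base (away (1 : A)), ?_, ?_⟩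
  · have : j.hom.base (away (1 : A)) ∈ (U : Set X.carrier) := hr ▸ ⟨_, rfl⟩
    exact this
  · intro W hW y hy
    have hy' : y ∈ (U : Set X.carrier) := hy
    rw [← hr] at hy'
    obtain ⟨q, rfl⟩ := hy'
    have := basicOpen_le_of_away_mem (U := (Opens.map j.hom.base).obj W) hW
    exact this (basicOpen_one (A := A) ▸ trivial : q ∈ basicOpen (1 : A))

/-- An affine open subset of a chart is one of the sets `D(f)`. -/
theorem preimage_eq_basicOpen {A : CommMonCat.{u}} (j : spec A ⟶ X.toSheafedSpace)
    (hj : SheafedSpace.IsOpenImmersion j) {U : Opens X.carrier} (hU : X.IsAffineOpen U)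
    (hUV : (U : Set X.carrier) ⊆ Set.range j.hom.base) :
    ∃ f : A, (Opens.map j.hom.base).obj U = basicOpen f := by
  obtain ⟨x, hx, h⟩ := exists_focal hU
  obtain ⟨p, rfl⟩ := hUV hx
  obtain ⟨f, hpf, hf⟩ := exists_basicOpen_le (U := (Opens.map j.hom.base).obj U) hx
  refine ⟨f, le_antisymm ?_ hf⟩
  intro q hq
  have hjf := h (hj.base_open.functor.obj (basicOpen f)) ⟨p, hpf, rfl⟩ (show j.hom.base q ∈ U from hq)
  obtain ⟨q', hq', he⟩ := hjf
  exact hj.base_open.injective he ▸ hq'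

/-- Sections over open subsets of a chart can be computed in the chart. -/
theorem isIso_app {A : CommMonCat.{u}} (j : spec A ⟶ X.toSheafedSpace)
    (hj : SheafedSpace.IsOpenImmersion j) {U : Opens X.carrier}
    (hUV : (U : Set X.carrier) ⊆ Set.range j.hom.base) : IsIso (j.hom.c.app (op U)) := by
  apply PresheafedSpace.IsOpenImmersion.c_iso' j.hom ((Opens.map j.hom.base).obj U)
  ext x
  constructor
  · intro hx
    obtain ⟨p, rfl⟩ := hUV hx
    exact ⟨p, hx, rfl⟩
  · rintro ⟨p, hp, rfl⟩
    exact hp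

/-- If an open subset `U` of an affine open subset `V` corresponds to `D(f)`, then the restriction
`𝒪(V) → 𝒪(U)` is the localization at the powers of the section corresponding to `f`. -/
theorem isLocalizationMap_res {A : CommMonCat.{u}} (j : spec A ⟶ X.toSheafedSpace)
    (hj : SheafedSpace.IsOpenImmersion j) {U V : Opens X.carrier} (hUV : U ≤ V)
    (hV : Set.range j.hom.base = V) (f : A) (hf : (Opens.map j.hom.base).obj U = basicOpen f)
    (g : X.presheaf.obj (op V))
    (hg : (j.hom.c.app (op V)).hom g = const f ((Opens.map j.hom.base).obj V)) :
    (Submonoid.powers g).IsLocalizationMap (X.res hUV) := by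
  have hisoV := isIso_app j hj (U := V) hV.ge
  have hisoU := isIso_app j hj (U := U) (subset_trans (show (U : Set X.carrier) ⊆ V from hUV) hV.ge)
  rw [ConcreteCategory.isIso_iff_bijective] at hisoU hisoV
  have hVt : (Opens.map j.hom.base).obj V = ⊤ := by
    apply top_le_iff.mp
    intro p _
    have : j.hom.base p ∈ (V : Set X.carrier) := hV ▸ ⟨p, rfl⟩
    exact this
  have hloc := isLocalizationMap_basicOpen f ((Opens.map j.hom.base).map (homOfLE hUV)) hf hVt
  let α : X.presheaf.obj (op V) →* sections ((Opens.map j.hom.base).obj V) :=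
    (j.hom.c.app (op V)).hom
  let β : X.presheaf.obj (op U) →* sections ((Opens.map j.hom.base).obj U) :=
    (j.hom.c.app (op U)).hom
  have hα : Function.Bijective α := hisoV
  have hβ : Function.Bijective β := hisoU
  let ρ := ((structurePresheaf A).map ((Opens.map j.hom.base).map (homOfLE hUV)).op).hom
  have hnat : ∀ s, β (X.res hUV s) = ρ (α s) := by
    intro s
    exact congrArg (fun t => t.hom s) (j.hom.c.naturality (homOfLE hUV).op)
  have hpow : ∀ n, α (g ^ n) = const f _ ^ n := fun n => by rw [map_pow]; exact congrArg (· ^ n) hg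
  refine ⟨?_, ?_, ?_⟩
  · rintro ⟨_, n, rfl⟩
    have h1 : IsUnit (β (X.res hUV (g ^ n))) := by
      rw [hnat, hpow]
      exact hloc.map_units ⟨_, n, rfl⟩
    let e := MulEquiv.ofBijective β hβ
    have h2 := h1.map e.symm
    rwa [show e.symm (β (X.res hUV (g ^ n))) = X.res hUV (g ^ n) from e.symm_apply_apply _] at h2
  · intro z
    obtain ⟨⟨x, _, n, rfl⟩, hx⟩ := hloc.surj (β z)
    obtain ⟨x, rfl⟩ := hα.2 x
    refine ⟨(x, ⟨g ^ n, n, rfl⟩), hβ.1 ?_⟩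
    change β (z * X.res hUV (g ^ n)) = β (X.res hUV x)
    rw [map_mul, hnat, hnat, hpow]
    exact hx
  · intro x y hxy
    have : ρ (α x) = ρ (α y) := by rw [← hnat, ← hnat, hxy]
    obtain ⟨⟨_, n, rfl⟩, hn⟩ := hloc.exists_of_eq this
    refine ⟨⟨g ^ n, n, rfl⟩, hα.1 ?_⟩
    change α (g ^ n * x) = α (g ^ n * y)
    rw [map_mul, map_mul, hpow]
    exact hn

end MonoidScheme

/-! ### Base change to a ring -/

section MonoidAlgebra

variable {k : Type u} [CommRing k] {A B : Type u} [CommMonoid A] [CommMonoid B]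

/-- The localization of a monoid at the powers of an element becomes the localization of its
monoid algebra. -/
theorem isLocalization_away_mapDomain {φ : A →* B} {f : A}
    (h : (Submonoid.powers f).IsLocalizationMap φ) :
    let _ := (MonoidAlgebra.mapDomainRingHom k φ).toAlgebra
    IsLocalization.Away (MonoidAlgebra.of k A f) (MonoidAlgebra k B) := by
  let _ := (MonoidAlgebra.mapDomainRingHom k φ).toAlgebra
  let g : MonoidAlgebra k A := MonoidAlgebra.of k A f
  let L := Localization.Away g
  let ι : MonoidAlgebra k A →+* L := algebraMap _ L
  let loc : (Submonoid.powers f).LocalizationMap B :=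
    { toFun := φ, map_mul' := map_mul φ, isLocalizationMap := h }
  have h11 : ι (MonoidAlgebra.single 1 1) = 1 := map_one ι
  have hu : ∀ s : Submonoid.powers f, IsUnit
      (((ι : MonoidAlgebra k A →* L).comp (MonoidAlgebra.of k A)) s) := by
    rintro ⟨_, n, rfl⟩
    change IsUnit (ι (MonoidAlgebra.of k A (f ^ n)))
    rw [map_pow, map_pow]
    exact (IsLocalization.Away.algebraMap_isUnit g).pow n
  let ψ : B →* L := loc.lift hu
  have hψ : ∀ a, ψ (φ a) = ι (MonoidAlgebra.of k A a) := fun a => loc.lift_eq hu a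
  let back : MonoidAlgebra k B →+* L :=
    MonoidAlgebra.liftNCRingHom (ι.comp MonoidAlgebra.singleOneRingHom) ψ fun _ _ => .all _ _
  have hgu : IsUnit (MonoidAlgebra.mapDomainRingHom k φ g) := by
    have : MonoidAlgebra.mapDomainRingHom k φ g = MonoidAlgebra.of k B (φ f) := by
      simp [g]
    rw [this]
    exact (h.map_units ⟨f, Submonoid.mem_powers f⟩).map (MonoidAlgebra.of k B)
  let fwd : L →+* MonoidAlgebra k B := IsLocalization.Away.lift g hgu
  have hfwd : ∀ x, fwd (ι x) = MonoidAlgebra.mapDomainRingHom k φ x :=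
    fun x => IsLocalization.Away.lift_eq g hgu x
  have hback : ∀ x, back (MonoidAlgebra.mapDomainRingHom k φ x) = ι x := by
    intro x
    refine congrArg (fun r : MonoidAlgebra k A →+* L => r x)
      (?_ : back.comp (MonoidAlgebra.mapDomainRingHom k φ) = ι)
    apply MonoidAlgebra.ringHom_ext
    · intro r
      simp [back, MonoidAlgebra.liftNCRingHom]
    · intro a
      simpa [back, MonoidAlgebra.liftNCRingHom, h11] using hψ a
  have h1 : fwd.comp back = RingHom.id _ := by
    have hs : ∀ b, fwd (ψ b) = MonoidAlgebra.of k B b := by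
      have : ((fwd : L →* MonoidAlgebra k B).comp ψ) = MonoidAlgebra.of k B := by
        refine loc.epic_of_localizationMap ?_
        apply MonoidHom.ext
        intro a
        change fwd (ψ (φ a)) = MonoidAlgebra.of k B (φ a)
        rw [hψ, hfwd]
        simp
      exact fun b => congrArg (fun t : B →* _ => t b) this
    apply MonoidAlgebra.ringHom_ext
    · intro r
      simp [back, MonoidAlgebra.liftNCRingHom, hfwd]
    · intro b
      simpa [back, MonoidAlgebra.liftNCRingHom, h11] using hs b
  have h2 : back.comp fwd = RingHom.id _ := by
    apply IsLocalization.ringHom_ext (Submonoid.powers g)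
    apply RingHom.ext
    intro x
    exact (congrArg back (hfwd x)).trans (hback x)
  let e : L ≃ₐ[MonoidAlgebra k A] MonoidAlgebra k B :=
    AlgEquiv.ofRingEquiv (f := RingEquiv.ofRingHom fwd back h1 h2) hfwd
  exact IsLocalization.isLocalization_of_algEquiv (Submonoid.powers g) e

end MonoidAlgebra

/-- For a commutative monoid `A` this is `Spec k[A]` as a scheme over `Spec k`. The bialgebra
structure of `k[A]`, given by `a ↦ a ⊗ a`, makes it a monoid object. -/
def diag (k : CommRingCat.{u}) (A : Type u) [CommMonoid A] : Over (Spec k) :=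
  (Spec (CommRingCat.of (MonoidAlgebra k A))).asOver (Spec k)

instance (k : CommRingCat.{u}) (A : Type u) [CommMonoid A] : MonObj (diag k A) :=
  inferInstanceAs (MonObj ((Spec (CommRingCat.of (MonoidAlgebra k A))).asOver (Spec k)))

/-- The morphism `Spec k[B] ⟶ Spec k[A]` induced by `φ : A → B`. -/
def diagMap (k : CommRingCat.{u}) {A B : Type u} [CommMonoid A] [CommMonoid B] (φ : A →* B) :
    diag k B ⟶ diag k A :=
  Over.homMk (Spec.map (CommRingCat.ofHom (MonoidAlgebra.mapDomainRingHom k φ))) (by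
    change Spec.map _ ≫ Spec.map (CommRingCat.ofHom (algebraMap k (MonoidAlgebra k A))) =
      Spec.map (CommRingCat.ofHom (algebraMap k (MonoidAlgebra k B)))
    rw [← Spec.map_comp, ← CommRingCat.ofHom_comp]
    congr 2
    ext r
    simp)

theorem diagMap_left (k : CommRingCat.{u}) {A B : Type u} [CommMonoid A] [CommMonoid B]
    (φ : A →* B) : (diagMap k φ).left =
      Spec.map (CommRingCat.ofHom (MonoidAlgebra.mapDomainRingHom k φ)) := rfl

theorem diagMap_id (k : CommRingCat.{u}) {A : Type u} [CommMonoid A] :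
    diagMap k (MonoidHom.id A) = 𝟙 (diag k A) := by
  apply Over.OverMorphism.ext
  rw [diagMap_left, Over.id_left]
  exact (congrArg (fun t => Spec.map (CommRingCat.ofHom t))
    (MonoidAlgebra.mapDomainRingHom_id (R := k) (M := A))).trans (Spec.map_id _)

theorem diagMap_comp (k : CommRingCat.{u}) {A B C : Type u} [CommMonoid A] [CommMonoid B]
    [CommMonoid C] (φ : A →* B) (ψ : B →* C) :
    diagMap k (ψ.comp φ) = diagMap k ψ ≫ diagMap k φ := by
  apply Over.OverMorphism.ext
  have h := Spec.map_comp (CommRingCat.ofHom (MonoidAlgebra.mapDomainRingHom k φ))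
    (CommRingCat.ofHom (MonoidAlgebra.mapDomainRingHom k ψ))
  rw [← CommRingCat.ofHom_comp, ← MonoidAlgebra.mapDomainRingHom_comp] at h
  exact h

theorem isOpenImmersion_diagMap (k : CommRingCat.{u}) {A B : Type u} [CommMonoid A]
    [CommMonoid B] {φ : A →* B} {f : A} (h : (Submonoid.powers f).IsLocalizationMap φ) :
    IsOpenImmersion (diagMap k φ).left ∧ Set.range (diagMap k φ).left =
      (PrimeSpectrum.basicOpen (MonoidAlgebra.of k A f) : Set (PrimeSpectrum (MonoidAlgebra k A))) := by
  let _ := (MonoidAlgebra.mapDomainRingHom k φ).toAlgebra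
  have := isLocalization_away_mapDomain (k := k) h
  exact ⟨IsOpenImmersion.of_isLocalization (R := MonoidAlgebra k A) (S := MonoidAlgebra k B)
    (MonoidAlgebra.of k A f),
    PrimeSpectrum.localization_away_comap_range (MonoidAlgebra k B) (MonoidAlgebra.of k A f)⟩

namespace MonoidScheme

open MonoidSpectrum

variable (X : MonoidScheme.{u}) (k : CommRingCat.{u})

/-- The diagram `U ↦ Spec k[𝒪(U)]`, where `U` runs through the affine open subsets of `X`. -/
def baseChangeDiagram : X.AffineOpens ⥤ Over (Spec k) where
  obj U := diag k (X.presheaf.obj (op U.1))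
  map i := diagMap k (X.res i.le)
  map_id U := by
    rw [← diagMap_id]
    congr 1
    exact congrArg CommMonCat.Hom.hom (X.presheaf.map_id _)
  map_comp {U V W} i j := by
    have h₁ : U.1 ≤ V.1 := i.le
    have h₂ : V.1 ≤ W.1 := j.le
    have e := X.presheaf.map_comp (homOfLE h₂).op (homOfLE h₁).op
    have h : X.res (i ≫ j).le = (X.res i.le).comp (X.res j.le) := congrArg CommMonCat.Hom.hom e
    exact (congrArg (diagMap k) h).trans (diagMap_comp k _ _)

variable {X} in
theorem exists_app_eq {A : CommMonCat.{u}} (j : spec A ⟶ X.toSheafedSpace)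
    (hj : SheafedSpace.IsOpenImmersion j) {V : Opens X.carrier}
    (hV : Set.range j.hom.base = V) (f : A) : ∃ g : X.presheaf.obj (op V),
      (j.hom.c.app (op V)).hom g = const f ((Opens.map j.hom.base).obj V) := by
  have h := isIso_app j hj hV.ge
  rw [ConcreteCategory.isIso_iff_bijective] at h
  exact h.2 _

variable {X} in
/-- The set `D(f)` is isomorphic to the spectrum of the localization at the powers of `f`. -/
theorem isAffineOpen_basicOpen {A : CommMonCat.{u}} (j : spec A ⟶ X.toSheafedSpace)
    (hj : SheafedSpace.IsOpenImmersion j) (f : A) :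
    X.IsAffineOpen (hj.base_open.functor.obj (basicOpen f)) := by
  let φ : A ⟶ CommMonCat.of (Localization (Submonoid.powers f)) :=
    CommMonCat.ofHom (Localization.monoidOf (Submonoid.powers f)).toMonoidHom
  have h : (Submonoid.powers f).IsLocalizationMap φ.hom :=
    (Localization.monoidOf (Submonoid.powers f)).isLocalizationMap
  have := isOpenImmersion_specMap φ f h
  refine ⟨_, specMap φ ≫ j, PresheafedSpace.IsOpenImmersion.comp (specMap φ).hom j.hom, ?_⟩
  have hr : Set.range (specMap φ).hom.base = (basicOpen f : Set (MonoidSpectrum A)) :=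
    range_comap h
  change Set.range (j.hom.base ∘ (specMap φ).hom.base) = j.hom.base '' (basicOpen f : Set (MonoidSpectrum A))
  rw [Set.range_comp, hr]

instance {U V : X.AffineOpens} (i : U ⟶ V) :
    IsOpenImmersion ((X.baseChangeDiagram k).map i).left := by
  obtain ⟨A, j, hj, hV⟩ := V.2
  have hUV : U.1 ≤ V.1 := i.le
  obtain ⟨f, hf⟩ := preimage_eq_basicOpen j hj U.2
    (subset_trans (show (U.1 : Set X.carrier) ⊆ V.1 from hUV) hV.ge)
  obtain ⟨g, hg⟩ := exists_app_eq j hj hV f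
  exact (isOpenImmersion_diagMap k (isLocalizationMap_res j hj hUV hV f hf g hg)).1

instance : ((X.baseChangeDiagram k) ⋙ Over.forget (Spec k) ⋙
    AlgebraicGeometry.Scheme.forget).IsLocallyDirected where
  cond := by
    intro U₁ U₂ V i₁ i₂ x₁ x₂ hx
    obtain ⟨A, j, hj, hV⟩ := V.2
    have h₁ : U₁.1 ≤ V.1 := i₁.le
    have h₂ : U₂.1 ≤ V.1 := i₂.le
    obtain ⟨f₁, hf₁⟩ := preimage_eq_basicOpen j hj U₁.2
      (subset_trans (show (U₁.1 : Set X.carrier) ⊆ V.1 from h₁) hV.ge)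
    obtain ⟨f₂, hf₂⟩ := preimage_eq_basicOpen j hj U₂.2
      (subset_trans (show (U₂.1 : Set X.carrier) ⊆ V.1 from h₂) hV.ge)
    obtain ⟨g₁, hg₁⟩ := exists_app_eq j hj hV f₁
    obtain ⟨g₂, hg₂⟩ := exists_app_eq j hj hV f₂
    let W : X.AffineOpens := ⟨_, isAffineOpen_basicOpen j hj (f₁ * f₂)⟩
    have hW : (Opens.map j.hom.base).obj W.1 = basicOpen (f₁ * f₂) :=
      Opens.ext (Set.preimage_image_eq _ hj.base_open.injective)
    have hW₁ : W ≤ U₁ := by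
      rintro _ ⟨p, hp, rfl⟩
      have : p ∈ basicOpen f₁ := (mul_mem_compl.mp hp).1
      rw [← hf₁] at this
      exact this
    have hW₂ : W ≤ U₂ := by
      rintro _ ⟨p, hp, rfl⟩
      have : p ∈ basicOpen f₂ := (mul_mem_compl.mp hp).2
      rw [← hf₂] at this
      exact this
    have hWV : W.1 ≤ V.1 := hW₁.trans h₁
    have r₁ := (isOpenImmersion_diagMap k (isLocalizationMap_res j hj h₁ hV f₁ hf₁ g₁ hg₁))
    have r₂ := (isOpenImmersion_diagMap k (isLocalizationMap_res j hj h₂ hV f₂ hf₂ g₂ hg₂))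
    have hg : (j.hom.c.app (op V.1)).hom (g₁ * g₂) =
        const (f₁ * f₂) ((Opens.map j.hom.base).obj V.1) :=
      ((map_mul (j.hom.c.app (op V.1)).hom g₁ g₂).trans (congrArg₂ (· * ·) hg₁ hg₂)).trans
        (const_mul f₁ f₂ _).symm
    have r := (isOpenImmersion_diagMap k
      (isLocalizationMap_res j hj hWV hV (f₁ * f₂) hW (g₁ * g₂) hg))
    let y := (diagMap k (X.res h₁)).left x₁
    have hy : y = (diagMap k (X.res h₂)).left x₂ := hx
    have m₁ : y ∈ PrimeSpectrum.basicOpen (MonoidAlgebra.of k _ g₁) := by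
      have : y ∈ Set.range (diagMap k (X.res h₁)).left := ⟨x₁, rfl⟩
      rw [r₁.2] at this
      exact this
    have m₂ : y ∈ PrimeSpectrum.basicOpen (MonoidAlgebra.of k _ g₂) := by
      have : y ∈ Set.range (diagMap k (X.res h₂)).left := ⟨x₂, hy.symm⟩
      rw [r₂.2] at this
      exact this
    have m : y ∈ Set.range (diagMap k (X.res hWV)).left := by
      rw [r.2, map_mul, PrimeSpectrum.basicOpen_mul]
      exact ⟨m₁, m₂⟩
    obtain ⟨x, hx'⟩ := m
    have c : ∀ {U : X.AffineOpens} (hU : W ≤ U) (hUV : U ≤ V),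
        (diagMap k (X.res hUV)).left ((diagMap k (X.res hU)).left x) = y := by
      intro U hU hUV
      have e := (X.baseChangeDiagram k).map_comp (homOfLE hU) (homOfLE hUV)
      exact (congrArg (fun t => t.left x) e).symm.trans hx'
    have := r₁.1
    have := r₂.1
    refine ⟨W, homOfLE hW₁, homOfLE hW₂, x, ?_, ?_⟩
    · exact (diagMap k (X.res h₁)).left.isOpenEmbedding.injective (c hW₁ h₁)
    · exact (diagMap k (X.res h₂)).left.isOpenEmbedding.injective ((c hW₂ h₂).trans hy)

/-- The base change `X_k` of `X` to a ring `k`, glued from the affine schemes `Spec k[𝒪(U)]`. -/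
def baseChange : Over (Spec k) := Limits.colimit (X.baseChangeDiagram k)

/-- The inclusion of `Spec k[𝒪(U)]` into `X_k`. -/
def chart (U : X.AffineOpens) : diag k (X.presheaf.obj (op U.1)) ⟶ X.baseChange k :=
  Limits.colimit.ι (X.baseChangeDiagram k) U

end MonoidScheme

/-! ### Toric varieties -/

open CartesianMonoidalCategory

/-- The torus `GL₁ʳ = Spec ℂ[ℤʳ]`. -/
abbrev torus (r : ℕ) : Over (Spec (CommRingCat.of ℂ)) :=
  diag (CommRingCat.of ℂ) (Multiplicative (Fin r → ℤ))

section Action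

variable {S : AlgebraicGeometry.Scheme.{u}} {M V : Over S} [MonObj M] (a : ModObj M V)

/-- The orbit map `m ↦ m · v` of an `S`-point `v` of `V`. -/
def orbitMap (v : 𝟙_ (Over S) ⟶ V) : M ⟶ V := lift (𝟙 M) (toUnit M ≫ v) ≫ a.smul

/-- The translation `x ↦ m · x` by an `S`-point `m` of `M`. -/
def translation (m : 𝟙_ (Over S) ⟶ M) : V ⟶ V := lift (toUnit V ≫ m) (𝟙 V) ≫ a.smul

end Action

/-- A toric variety is an irreducible variety over `ℂ`, that is, an integral scheme of finite type
over `ℂ`, with an action of the torus `GL₁ʳ` such that the orbit of some `ℂ`-point is open. -/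
structure IsToricVariety {r : ℕ} {V : Over (Spec (CommRingCat.of ℂ))}
    (a : ModObj (torus r) V) : Prop where
  isIntegral : AlgebraicGeometry.IsIntegral V.left
  locallyOfFiniteType : LocallyOfFiniteType V.hom
  quasiCompact : QuasiCompact V.hom
  exists_open_orbit : ∃ v : 𝟙_ (Over (Spec (CommRingCat.of ℂ))) ⟶ V,
    IsOpen (Set.range (orbitMap a v).left)

section Component

variable {S : AlgebraicGeometry.Scheme.{u}} {Y : Over S} (Z : irreducibleComponents Y.left)

/-- An irreducible component with its reduced induced scheme structure. -/
def component : Over S :=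
  Over.mk ((AlgebraicGeometry.Scheme.IdealSheafData.vanishingIdeal
    ⟨Z.1, isClosed_of_mem_irreducibleComponents Z.1 Z.2⟩).subschemeι ≫ Y.hom)

/-- The inclusion of an irreducible component. -/
def componentι : component Z ⟶ Y :=
  Over.homMk (AlgebraicGeometry.Scheme.IdealSheafData.vanishingIdeal
    ⟨Z.1, isClosed_of_mem_irreducibleComponents Z.1 Z.2⟩).subschemeι

end Component

namespace MonoidScheme

variable (X : MonoidScheme.{u})

/-- The stalk of the structure sheaf at a point: the filtered colimit of the monoids of sections over
the open neighbourhoods of the point. -/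
def stalk (x : X.carrier) : CommMonCat.{u} :=
  CommMonCat.FilteredColimits.colimit ((OpenNhds.inclusion x).op ⋙ X.presheaf)

/-- The homomorphism from the sections over an open neighbourhood of a point to the stalk. -/
def toStalk (U : Opens X.carrier) (x : X.carrier) (h : x ∈ U) :
    X.presheaf.obj (op U) →* X.stalk x :=
  ((CommMonCat.FilteredColimits.colimitCocone ((OpenNhds.inclusion x).op ⋙ X.presheaf)).ι.app
    (op ⟨U, h⟩)).hom

/-- An action of `Spec k[G]` on `X_k`, where `G` is the stalk of `X` at `η`, is the canonical one if
it is given on each affine chart `Spec k[A]` by `k[A] → k[G] ⊗ k[A]`, `a ↦ φ(a) ⊗ a`, where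
`φ : A → G` is the map to the stalk, that is, by the morphism `Spec k[G] ⟶ Spec k[A]` followed by
the multiplication of `Spec k[A]`. -/
def IsCanonicalAction (k : CommRingCat.{u}) (η : X.carrier)
    (a : ModObj (diag k (X.stalk η)) (X.baseChange k)) : Prop :=
  ∀ (U : X.AffineOpens) (h : η ∈ U.1),
    (diag k (X.stalk η) ◁ X.chart k U) ≫ a.smul =
      (diagMap k (X.toStalk U.1 η h) ▷ diag k (X.presheaf.obj (op U.1))) ≫ MonObj.mul ≫
        X.chart k U

end MonoidScheme
end FOne

end

open FOne

/-! Everything reduces to a dense open copy of `Spec ℂ[G]` inside `X_ℂ`. In `spec A` the empty prime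
lies in every nonempty open set, and connectedness spreads such a point over all of `X`
(`exists_mem_of_nonempty`). If `A` is generated by finitely many elements with product `f`, then
`D(f)` contains only the empty prime, so `{η}` is itself an affine open set
(`exists_affineOpen_eq_singleton`). Its sections are the stalk `G`, all of them are units, and every
`A → G` is a localization at the powers of one element, injective by cancellation. Hence `G` is a
finitely generated abelian group `ℤʳ × F`, `Spec ℂ[G]` is open in `X_ℂ`, and it is dense because
each `ℂ[A] → ℂ[G]` is injective (`denseRange_stalkChart_left`). The formula `a ↦ φ(a) ⊗ a` is
compatible with localization, so the actions on the charts glue (`exists_action`); on `Spec ℂ[G]`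
the result is multiplication (`whiskerLeft_stalkChart`).

Modulo a prime of `ℂ[G]` each element of the finite group `F` becomes a root of unity, which defines
a character. So `Spec ℂ[G]` is a finite disjoint union of open translates of the torus, called
cells, one for each character `χ : F → ℂˣ` (`exists_mem_range`, `eq_of_mem_range`). The cells are
irreducible with dense union, so every irreducible component of `X_ℂ` is the closure of a cell.

The torus preserves a component `Z`: `GL₁ʳ × Z` is integral, so its image under the action is
irreducible; it contains `Z`, hence equals `Z` by maximality. Since the product is reduced, the
action factors through the reduced structure of `Z`. The cell is an open orbit in `Z`. Finally,
translation by `χ'χ⁻¹` carries the cell of `χ` onto that of `χ'`, hence one closure onto the other,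
and it commutes with the torus because `G` acts through a commutative group scheme. -/

noncomputable section

namespace FOne

open CartesianMonoidalCategory Limits

/-! ### Gluing morphisms along families of open immersions -/

section Gluing

/-- An open cover given by a jointly surjective family of open immersions. -/
def openCoverOfSurjective {W : AlgebraicGeometry.Scheme.{u}} {J : Type u}
    {V : J → AlgebraicGeometry.Scheme.{u}}
    (f : ∀ j, V j ⟶ W) (hf : ∀ j, IsOpenImmersion (f j)) (hs : ∀ x, ∃ j y, f j y = x) :
    W.OpenCover where
  I₀ := J
  X := V
  f := f
  mem₀ := by
    rw [Scheme.presieve₀_mem_precoverage_iff]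
    exact ⟨hs, hf⟩

variable {W Y : AlgebraicGeometry.Scheme.{u}} {J : Type u} {V : J → AlgebraicGeometry.Scheme.{u}}
  (f : ∀ j, V j ⟶ W) (hf : ∀ j, IsOpenImmersion (f j)) (hs : ∀ x, ∃ j y, f j y = x)

include hf hs in
theorem hom_ext_of_surjective {g h : W ⟶ Y} (H : ∀ j, f j ≫ g = f j ≫ h) : g = h :=
  (openCoverOfSurjective f hf hs).hom_ext g h H

include hf hs in
/-- Morphisms glue if the intersections of the members of the cover are covered by members of the
cover on which the morphisms agree. -/
theorem exists_glue (g : ∀ j, V j ⟶ Y)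
    (hg : ∀ i j (x : V i) (y : V j), f i x = f j y → ∃ (k : J) (p : V k ⟶ V i) (q : V k ⟶ V j)
      (z : V k), p z = x ∧ p ≫ f i = f k ∧ q ≫ f j = f k ∧ p ≫ g i = q ≫ g j) :
    ∃ h : W ⟶ Y, ∀ j, f j ≫ h = g j := by
  refine ⟨(openCoverOfSurjective f hf hs).glueMorphisms g fun i j => ?_,
    fun j => (openCoverOfSurjective f hf hs).ι_glueMorphisms g _ j⟩
  change pullback.fst (f i) (f j) ≫ g i = pullback.snd (f i) (f j) ≫ g j
  have hij : ∀ t : (pullback (f i) (f j) : AlgebraicGeometry.Scheme.{u}),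
      f i (pullback.fst (f i) (f j) t) = f j (pullback.snd (f i) (f j) t) := by
    intro t
    rw [← Scheme.Hom.comp_apply, ← Scheme.Hom.comp_apply, pullback.condition]
  choose k p q z hz hp hq hpq using fun t => hg i j _ _ (hij t)
  have := hf i
  have := hf j
  -- For each point `t` of the overlap, the member `V (k t)` maps to the overlap by an open
  -- immersion through `t`; these maps cover it, so agreement can be tested on them.
  let l : ∀ t, V (k t) ⟶ pullback (f i) (f j) := fun t =>
    pullback.lift (p t) (q t) ((hp t).trans (hq t).symm)
  have hlp : ∀ t, l t ≫ pullback.fst (f i) (f j) = p t := fun t => pullback.lift_fst _ _ _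
  have hlq : ∀ t, l t ≫ pullback.snd (f i) (f j) = q t := fun t => pullback.lift_snd _ _ _
  refine hom_ext_of_surjective l (fun t => ?_) (fun t => ⟨t, z t, ?_⟩) fun t => ?_
  · have h1 : IsOpenImmersion ((l t ≫ pullback.fst (f i) (f j)) ≫ f i) := by
      rw [hlp, hp]
      exact hf _
    have h2 := IsOpenImmersion.of_comp (l t ≫ pullback.fst (f i) (f j)) (f i)
    exact IsOpenImmersion.of_comp (l t) (pullback.fst (f i) (f j))
  · apply (pullback.fst (f i) (f j)).isOpenEmbedding.injective
    rw [← Scheme.Hom.comp_apply, hlp]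
    exact hz t
  · rw [← Category.assoc, ← Category.assoc, hlp, hlq]
    exact hpq t

end Gluing

/-! ### Open covers of a product `M ⊗ W` induced from `W` -/

section Tensor

variable {S : AlgebraicGeometry.Scheme.{u}} (M : Over S)

theorem isOpenImmersion_whiskerLeft_left {V W : Over S} (f : V ⟶ W) (hf : IsOpenImmersion f.left) :
    IsOpenImmersion (M ◁ f).left := by
  rw [Over.whiskerLeft_left]
  infer_instance

theorem range_whiskerLeft_left {V W : Over S} (f : V ⟶ W) :
    Set.range (M ◁ f).left = (snd M W).left ⁻¹' Set.range f.left := by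
  rw [Over.whiskerLeft_left]
  refine (Scheme.Pullback.range_map ..).trans ?_
  simp

variable {D : Type u} {V : D → Over S} {W Y : Over S} (f : ∀ j, V j ⟶ W)
  (hf : ∀ j, IsOpenImmersion (f j).left) (hs : ∀ x, ∃ j y, (f j).left y = x)

include hs in
theorem exists_whiskerLeft_left_apply_eq (x : (M ⊗ W).left) :
    ∃ j y, (M ◁ f j).left y = x := by
  obtain ⟨j, y, hy⟩ := hs ((snd M W).left x)
  have : x ∈ Set.range (M ◁ f j).left := by
    rw [range_whiskerLeft_left]
    exact ⟨y, hy⟩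
  exact ⟨j, this⟩

-- The overlap condition concerns only points of `W`: the image of `M ◁ p` is the full preimage of
-- the image of `p`, so a cover of an overlap in `W` also covers the overlap in `M ⊗ W`.
include hf hs in
theorem tensor_hom_ext {g h : M ⊗ W ⟶ Y} (H : ∀ j, M ◁ f j ≫ g = M ◁ f j ≫ h) : g = h := by
  apply Over.OverMorphism.ext
  exact hom_ext_of_surjective (fun j => (M ◁ f j).left)
    (fun j => isOpenImmersion_whiskerLeft_left M (f j) (hf j))
    (exists_whiskerLeft_left_apply_eq M f hs) fun j => congrArg CommaMorphism.left (H j)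

include hf hs in
theorem exists_tensor_glue (g : ∀ j, M ⊗ V j ⟶ Y)
    (hg : ∀ i j (x : (V i).left) (y : (V j).left), (f i).left x = (f j).left y →
      ∃ (k : D) (p : V k ⟶ V i) (q : V k ⟶ V j) (z : (V k).left), p.left z = x ∧
        p ≫ f i = f k ∧ q ≫ f j = f k ∧ M ◁ p ≫ g i = g k ∧ M ◁ q ≫ g j = g k) :
    ∃ h : M ⊗ W ⟶ Y, ∀ j, M ◁ f j ≫ h = g j := by
  have hopen := fun j => isOpenImmersion_whiskerLeft_left M (f j) (hf j)
  have hsurj := exists_whiskerLeft_left_apply_eq M f hs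
  obtain ⟨h, hh⟩ := exists_glue (fun j => (M ◁ f j).left) hopen hsurj (fun j => (g j).left) <| by
    intro i j x y hxy
    have hsnd : ∀ {i} (x : (M ⊗ V i).left), (snd M W).left ((M ◁ f i).left x) =
        (f i).left ((snd M (V i)).left x) := by
      intro i x
      rw [← Scheme.Hom.comp_apply, ← Scheme.Hom.comp_apply, ← Over.comp_left, ← Over.comp_left,
        whiskerLeft_snd]
    obtain ⟨k, p, q, z, hz, hp, hq, hpg, hqg⟩ := hg i j ((snd M (V i)).left x)
      ((snd M (V j)).left y) (by rw [← hsnd, ← hsnd, hxy])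
    have hx : x ∈ Set.range (M ◁ p).left := by
      rw [range_whiskerLeft_left]
      exact ⟨z, hz⟩
    obtain ⟨w, hw⟩ := hx
    refine ⟨k, (M ◁ p).left, (M ◁ q).left, w, hw, ?_, ?_, ?_⟩
    · rw [← Over.comp_left, ← whiskerLeft_comp, hp]
    · rw [← Over.comp_left, ← whiskerLeft_comp, hq]
    · rw [← Over.comp_left, ← Over.comp_left, hpg, hqg]
  refine ⟨Over.homMk h ?_, fun j => Over.OverMorphism.ext (hh j)⟩
  refine hom_ext_of_surjective (fun j => (M ◁ f j).left) hopen hsurj fun j => ?_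
  rw [← Category.assoc, hh j, Over.w, Over.w]

end Tensor

/-! ### Locally directed colimits of open immersions over a base -/

section Colimit

variable {S : AlgebraicGeometry.Scheme.{u}} {J : Type u} [SmallCategory J] (D : J ⥤ Over S)
  [∀ {i j} (f : i ⟶ j), IsOpenImmersion (D.map f).left]
  [(D ⋙ Over.forget S ⋙ AlgebraicGeometry.Scheme.forget).IsLocallyDirected]
  [Quiver.IsThin J]

instance {i j : J} (f : i ⟶ j) : IsOpenImmersion ((D ⋙ Over.forget S).map f) :=
  inferInstanceAs (IsOpenImmersion (D.map f).left)

instance : ((D ⋙ Over.forget S) ⋙ AlgebraicGeometry.Scheme.forget).IsLocallyDirected :=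
  inferInstanceAs (D ⋙ Over.forget S ⋙ AlgebraicGeometry.Scheme.forget).IsLocallyDirected

/-- The forgetful functor to schemes preserves this colimit; the identity transfers the description
of colimits of schemes to `Over S`. -/
theorem colimitι_left_eq (j : J) : (colimit.ι D j).left =
    (colimit.ι (D ⋙ Over.forget S) j ≫ (preservesColimitIso (Over.forget S) D).inv :) :=
  (ι_preservesColimitIso_inv (Over.forget S) D j).symm

theorem isOpenImmersion_colimitι_left (j : J) : IsOpenImmersion (colimit.ι D j).left := by
  rw [colimitι_left_eq]
  exact inferInstanceAs (IsOpenImmersion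
    (colimit.ι (D ⋙ Over.forget S) j ≫ (preservesColimitIso (Over.forget S) D).inv))

theorem exists_colimitι_left_apply_eq (x : (colimit D).left) :
    ∃ (j : J) (y : (D.obj j).left), (colimit.ι D j).left y = x := by
  obtain ⟨j, y, hy⟩ := Scheme.IsLocallyDirected.ι_jointly_surjective (D ⋙ Over.forget S)
    ((preservesColimitIso (Over.forget S) D).hom x)
  refine ⟨j, y, ?_⟩
  rw [colimitι_left_eq]
  refine (Scheme.Hom.comp_apply (colimit.ι (D ⋙ Over.forget S) j) _ y).trans ?_
  rw [hy]
  exact (Scheme.Hom.comp_apply (preservesColimitIso (Over.forget S) D).hom _ x).symm.trans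
    (congrArg (fun t : (colimit D).left ⟶ (colimit D).left => t x)
      (preservesColimitIso (Over.forget S) D).hom_inv_id)

theorem exists_of_colimitι_left_apply_eq {i j : J} {x : (D.obj i).left} {y : (D.obj j).left}
    (h : (colimit.ι D i).left x = (colimit.ι D j).left y) :
    ∃ (k : J) (f : k ⟶ i) (g : k ⟶ j) (z : (D.obj k).left),
      (D.map f).left z = x ∧ (D.map g).left z = y := by
  rw [colimitι_left_eq, colimitι_left_eq] at h
  have h' := (preservesColimitIso (Over.forget S) D).inv.isOpenEmbedding.injective
    ((Scheme.Hom.comp_apply (colimit.ι (D ⋙ Over.forget S) i) _ x).symm.trans (h.trans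
      (Scheme.Hom.comp_apply (colimit.ι (D ⋙ Over.forget S) j) _ y)))
  obtain ⟨k, f, g, z, hz⟩ := (Scheme.IsLocallyDirected.ι_eq_ι_iff (D ⋙ Over.forget S)).mp h'
  exact ⟨k, f, g, z, hz⟩

end Colimit
end FOne

namespace FOne

/-! ### The empty prime ideal and global sections of `spec A` -/

namespace MonoidSpectrum

variable {A : Type u} [CommMonoid A]

/-- The empty prime ideal. -/
def empty (A : Type u) [CommMonoid A] : MonoidSpectrum A where
  asSet := ∅
  mul_mem _ _ h := h
  one_notMem h := h
  mem_or_mem h := h.elim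

theorem mem_compl_empty (a : A) : a ∈ (empty A).compl := fun h => h

theorem empty_mem {U : Opens (MonoidSpectrum A)} (hU : (U : Set (MonoidSpectrum A)).Nonempty) :
    empty A ∈ U := by
  obtain ⟨p, hp⟩ := hU
  obtain ⟨f, -, hf⟩ := exists_basicOpen_le hp
  exact hf (mem_compl_empty f)

theorem eq_empty_of_forall {p : MonoidSpectrum A} (h : ∀ a, a ∈ p.compl) : p = empty A := by
  ext a
  exact ⟨fun ha => (h a ha).elim, fun ha => ha.elim⟩

/-- If `A` is finitely generated, then the empty prime ideal is an open point. -/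
theorem exists_basicOpen_eq_singleton (h : Monoid.FG A) :
    ∃ f : A, (basicOpen f : Set (MonoidSpectrum A)) = {empty A} := by
  obtain ⟨S, hS⟩ := h.fg_top
  -- A prime that avoids the product of the generators avoids each of them, hence every element.
  refine ⟨∏ a ∈ S, a, Set.eq_singleton_iff_unique_mem.mpr ⟨mem_compl_empty _, fun p hp => ?_⟩⟩
  classical
  have hp' : ∏ a ∈ S, a ∈ p.compl := hp
  have hle : Submonoid.closure (S : Set A) ≤ p.compl := by
    rw [Submonoid.closure_le]
    intro a ha
    rw [← Finset.mul_prod_erase S _ ha] at hp'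
    exact (mul_mem_compl.mp hp').1
  exact eq_empty_of_forall fun a => hle (hS ▸ Submonoid.mem_top a)

/-- The non-units form the prime ideal `away 1`; if it coincides with the empty one, there are none.
-/
theorem isUnit_of_subsingleton [Subsingleton (MonoidSpectrum A)] (a : A) : IsUnit a := by
  have h : away (1 : A) = empty A := Subsingleton.elim _ _
  have ha : a ∈ (away (1 : A)).compl := h ▸ mem_compl_empty a
  obtain ⟨n, hn⟩ := mem_compl_away.mp ha
  rw [one_pow] at hn
  exact isUnit_of_dvd_one hn

/-- The global sections of `spec A` are the elements of `A`. -/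
theorem bijective_const_top {U : Opens (top A)} (hU : U = ⊤) :
    Function.Bijective fun a : A => const a U := by
  obtain rfl : U = basicOpen 1 := hU.trans basicOpen_one.symm
  constructor
  · intro a b h
    obtain ⟨n, hn⟩ := exists_of_const_eq h
    simpa using hn
  · intro s
    obtain ⟨a, n, h⟩ := exists_section_eq 1 s
    rw [one_pow, const_one, mul_one] at h
    exact ⟨a, h.symm⟩

end MonoidSpectrum

/-! ### The generic point of a connected scheme over `𝔽₁` -/

namespace MonoidScheme

open MonoidSpectrum

variable {X : MonoidScheme.{u}}

theorem map_eq_top {A : CommMonCat.{u}} {j : spec A ⟶ X.toSheafedSpace} {V : Opens X.carrier}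
    (hV : Set.range j.hom.base = V) : (Opens.map j.hom.base).obj V = ⊤ := by
  refine top_le_iff.mp fun p _ => ?_
  have : j.hom.base p ∈ (V : Set X.carrier) := hV ▸ ⟨p, rfl⟩
  exact this

/-- The sections over the image of an open immersion `spec A ⟶ X` are the elements of `A`. -/
def sectionsEquiv {A : CommMonCat.{u}} {j : spec A ⟶ X.toSheafedSpace}
    (hj : SheafedSpace.IsOpenImmersion j) {V : Opens X.carrier} (hV : Set.range j.hom.base = V) :
    X.presheaf.obj (op V) ≃* A :=
  let W := (Opens.map j.hom.base).obj V
  let α : X.presheaf.obj (op V) →* sections W := (j.hom.c.app (op V)).hom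
  have hα : Function.Bijective α := by
    have := isIso_app j hj (U := V) hV.ge
    exact (ConcreteCategory.isIso_iff_bijective _).mp this
  let β : A →* sections W :=
    { toFun := fun a => const a W
      map_one' := const_one _
      map_mul' := fun a b => const_mul a b _ }
  (MulEquiv.ofBijective α hα).trans
    (MulEquiv.ofBijective β (bijective_const_top (map_eq_top hV))).symm

/-- Every nonempty open subset of an affine open subset contains its generic point. -/
theorem apply_empty_mem {A : CommMonCat.{u}} (j : spec A ⟶ X.toSheafedSpace) {W : Opens X.carrier}
    (h : (Set.range j.hom.base ∩ W).Nonempty) : j.hom.base (empty A) ∈ W := by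
  obtain ⟨_, ⟨p, rfl⟩, hp⟩ := h
  exact empty_mem (U := (Opens.map j.hom.base).obj W) ⟨p, hp⟩

theorem exists_affineOpen (x : X.carrier) : ∃ U : X.AffineOpens, x ∈ U.1 := by
  obtain ⟨A, j, hj, hx⟩ := X.exists_chart x
  exact ⟨⟨⟨_, hj.base_open.isOpen_range⟩, A, j, hj, rfl⟩, hx⟩

theorem affineOpen_nonempty (U : X.AffineOpens) : (U.1 : Set X.carrier).Nonempty := by
  obtain ⟨x, hx, -⟩ := exists_focal U.2
  exact ⟨x, hx⟩

theorem exists_generic_affineOpen (U : X.AffineOpens) :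
    ∃ x ∈ U.1, ∀ W : Opens X.carrier, ((U.1 : Set X.carrier) ∩ W).Nonempty → x ∈ W := by
  obtain ⟨A, j, -, hr⟩ := U.2
  refine ⟨j.hom.base (empty A), ?_, fun W hW => apply_empty_mem j (hr ▸ hW)⟩
  have : j.hom.base (empty A) ∈ (U.1 : Set X.carrier) := hr ▸ ⟨_, rfl⟩
  exact this

/-- A connected scheme over `𝔽₁` has a point which lies in every nonempty open subset. -/
theorem exists_mem_of_nonempty [ConnectedSpace X.carrier] :
    ∃ x : X.carrier, ∀ W : Opens X.carrier, (W : Set X.carrier).Nonempty → x ∈ W := by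
  obtain ⟨x₀⟩ := (inferInstance : Nonempty X.carrier)
  obtain ⟨U₀, hx₀⟩ := exists_affineOpen x₀
  obtain ⟨x, hx, hgen⟩ := exists_generic_affineOpen U₀
  -- Since `U` meets both `U₀` (in `x`) and `W`, the generic point `y` of `U` lies in both. Thus `W`
  -- meets `U₀`, whose generic point is `x`.
  have key : ∀ U : X.AffineOpens, x ∈ U.1 → ∀ W : Opens X.carrier,
      ((U.1 : Set X.carrier) ∩ W).Nonempty → x ∈ W := by
    intro U hU W hW
    obtain ⟨y, -, hy⟩ := exists_generic_affineOpen U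
    exact hgen W ⟨y, hy U₀.1 ⟨x, hU, hx⟩, hy W hW⟩
  -- An affine open set containing one specialization of `x` contains `x`, so by `key` it consists
  -- of specializations of `x`. Hence each affine open set lies either inside this set or outside
  -- it.
  have hclopen : IsClopen {y | x ⤳ y} := by
    have hsub : ∀ U : X.AffineOpens, x ∈ U.1 → (U.1 : Set X.carrier) ⊆ {y | x ⤳ y} := by
      intro U hU y hy
      rw [Set.mem_ofPred_eq, specializes_iff_forall_open]
      intro W hW hyW
      exact key U hU ⟨W, hW⟩ ⟨y, hy, hyW⟩
    constructor
    · rw [← isOpen_compl_iff, isOpen_iff_forall_mem_open]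
      intro y hy
      obtain ⟨U, hU⟩ := exists_affineOpen y
      refine ⟨U.1, fun z hz hxz => hy ?_, U.1.2, hU⟩
      exact hsub U (hxz.mem_open U.1.2 hz) hU
    · rw [isOpen_iff_forall_mem_open]
      intro y hy
      obtain ⟨U, hU⟩ := exists_affineOpen y
      exact ⟨U.1, hsub U (hy.mem_open U.1.2 hU), U.1.2, hU⟩
  have huniv := hclopen.eq_univ ⟨x, specializes_rfl⟩
  refine ⟨x, fun W ⟨y, hy⟩ => ?_⟩
  have : y ∈ {y | x ⤳ y} := huniv ▸ Set.mem_univ y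
  exact Specializes.mem_open this W.2 hy

/-! ### Stalks as filtered colimits -/

section Stalk

variable {x : X.carrier}

theorem toStalk_res {U V : Opens X.carrier} (h : U ≤ V) (hx : x ∈ U) (s : X.presheaf.obj (op V)) :
    X.toStalk U x hx (X.res h s) = X.toStalk V x (h hx) s := by
  let i : (⟨U, hx⟩ : OpenNhds x) ⟶ ⟨V, h hx⟩ := homOfLE h
  exact congrArg (fun t => t.hom s) ((CommMonCat.FilteredColimits.colimitCocone
    ((OpenNhds.inclusion x).op ⋙ X.presheaf)).w i.op)

theorem exists_toStalk_eq (g : X.stalk x) :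
    ∃ (U : Opens X.carrier) (hx : x ∈ U) (s : X.presheaf.obj (op U)), X.toStalk U x hx s = g := by
  let D := (OpenNhds.inclusion x).op ⋙ X.presheaf
  have hc := Limits.isColimitOfPreserves (forget CommMonCat.{u})
    (CommMonCat.FilteredColimits.colimitCoconeIsColimit D)
  obtain ⟨j, s, hs⟩ := Limits.Types.jointly_surjective _ hc g
  exact ⟨j.unop.1, j.unop.2, s, hs⟩

theorem exists_res_eq_of_toStalk_eq {U V : Opens X.carrier} {hU : x ∈ U} {hV : x ∈ V}
    {s : X.presheaf.obj (op U)} {t : X.presheaf.obj (op V)}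
    (h : X.toStalk U x hU s = X.toStalk V x hV t) :
    ∃ (W : Opens X.carrier) (_ : x ∈ W) (hWU : W ≤ U) (hWV : W ≤ V), X.res hWU s = X.res hWV t := by
  let D := (OpenNhds.inclusion x).op ⋙ X.presheaf
  have hc := Limits.isColimitOfPreserves (forget CommMonCat.{u})
    (CommMonCat.FilteredColimits.colimitCoconeIsColimit D)
  obtain ⟨k, f, g, hfg⟩ := (Limits.Types.FilteredColimit.isColimit_eq_iff _ hc
    (i := op ⟨U, hU⟩) (j := op ⟨V, hV⟩) (xi := s) (xj := t)).mp h
  exact ⟨k.unop.1, k.unop.2, f.unop.le, g.unop.le, hfg⟩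

/-- The stalk at an open point consists of the sections over that point. -/
theorem bijective_toStalk {U : Opens X.carrier} (hU : (U : Set X.carrier) = {x}) (hx : x ∈ U) :
    Function.Bijective (X.toStalk U x hx) := by
  have hle : ∀ W : Opens X.carrier, x ∈ W → U ≤ W := by
    intro W hW y hy
    have : y ∈ (U : Set X.carrier) := hy
    rw [hU, Set.mem_singleton_iff] at this
    exact this ▸ hW
  constructor
  · intro s t h
    obtain ⟨W, hW, h₁, h₂, he⟩ := exists_res_eq_of_toStalk_eq h
    obtain rfl : W = U := le_antisymm h₁ (hle W hW)
    have hid : ∀ s, X.res (le_refl W) s = s := fun s =>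
      congrArg (fun t => t.hom s) (X.presheaf.map_id (op W))
    exact (hid s).symm.trans (he.trans (hid t))
  · intro g
    obtain ⟨W, hW, s, rfl⟩ := exists_toStalk_eq g
    exact ⟨X.res (hle W hW) s, toStalk_res (hle W hW) hx s⟩

end Stalk

/-- The restriction between affine open subsets is a localization at the powers of an element. -/
theorem exists_isLocalizationMap_res {U V : X.AffineOpens} (h : U ≤ V) :
    ∃ g, (Submonoid.powers g).IsLocalizationMap (X.res h) := by
  obtain ⟨A, j, hj, hV⟩ := V.2
  have hUV : U.1 ≤ V.1 := h
  obtain ⟨f, hf⟩ := preimage_eq_basicOpen j hj U.2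
    (subset_trans (show (U.1 : Set X.carrier) ⊆ V.1 from hUV) hV.ge)
  obtain ⟨g, hg⟩ := exists_app_eq j hj hV f
  exact ⟨g, isLocalizationMap_res j hj hUV hV f hf g hg⟩

theorem isCancelMul_sections (hX : X.IsIntegral) (U : X.AffineOpens) :
    IsCancelMul (X.presheaf.obj (op U.1)) := by
  obtain ⟨A, j, hj, hU⟩ := U.2
  have := hX A j hj
  let e := sectionsEquiv hj hU
  exact Function.Injective.isCancelMul e e.injective (map_mul e)

/-- Two elements identified by a localization agree after multiplication by some `c`, which cancels.
-/
theorem res_injective (hX : X.IsIntegral) {U V : X.AffineOpens} (h : U ≤ V) :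
    Function.Injective (X.res h) := by
  obtain ⟨g, hg⟩ := exists_isLocalizationMap_res h
  have := isCancelMul_sections hX V
  intro s t hst
  obtain ⟨c, hc⟩ := hg.exists_of_eq hst
  exact mul_left_cancel hc

theorem isUnit_of_subsingleton_affineOpen (U : X.AffineOpens)
    (hU : (U.1 : Set X.carrier).Subsingleton)
    (s : X.presheaf.obj (op U.1)) : IsUnit s := by
  obtain ⟨A, j, hj, hr⟩ := U.2
  have : Subsingleton (MonoidSpectrum A) := by
    refine ⟨fun p q => hj.base_open.injective (hU ?_ ?_)⟩
    · rw [← hr]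
      exact ⟨p, rfl⟩
    · rw [← hr]
      exact ⟨q, rfl⟩
  let e := sectionsEquiv hj hr
  have h := (isUnit_of_subsingleton (e s)).map e.symm
  rwa [e.symm_apply_apply] at h

/-- A finite covering by spectra of finitely generated monoids, in terms of affine open subsets. -/
theorem IsOfFiniteType.exists_cover (h : X.IsOfFiniteType) :
    ∃ (n : ℕ) (U : Fin n → X.AffineOpens), (∀ i, Monoid.FG (X.presheaf.obj (op (U i).1))) ∧
      ∀ V : X.AffineOpens, ∃ i, V ≤ U i := by
  obtain ⟨n, A, j, hA, hcov⟩ := h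
  let U : Fin n → X.AffineOpens := fun i =>
    ⟨⟨_, (hA i).2.base_open.isOpen_range⟩, A i, j i, (hA i).2, rfl⟩
  refine ⟨n, U, fun i => ?_, fun V => ?_⟩
  · have := (hA i).1
    exact Monoid.fg_of_surjective (sectionsEquiv (hA i).2 (V := (U i).1) rfl).symm.toMonoidHom
      (MulEquiv.surjective _)
  -- The affine open set `V` is the smallest neighbourhood of some point `x`, so any member of the
  -- covering that contains `x` contains all of `V`.
  · obtain ⟨x, -, hV⟩ := exists_focal V.2
    obtain ⟨i, hi⟩ := hcov x
    exact ⟨i, hV (U i).1 hi⟩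

/-- On an affine open subset with finitely generated sections the generic point is open. -/
theorem exists_affineOpen_eq_singleton {x : X.carrier}
    (hx : ∀ W : Opens X.carrier, (W : Set X.carrier).Nonempty → x ∈ W) (U : X.AffineOpens)
    (hU : Monoid.FG (X.presheaf.obj (op U.1))) :
    ∃ U₀ : X.AffineOpens, (U₀.1 : Set X.carrier) = {x} := by
  obtain ⟨A, j, hj, hr⟩ := U.2
  have hA : Monoid.FG A := Monoid.fg_of_surjective (sectionsEquiv hj hr).toMonoidHom
    (MulEquiv.surjective _)
  obtain ⟨f, hf⟩ := exists_basicOpen_eq_singleton hA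
  let U₀ : X.AffineOpens := ⟨_, isAffineOpen_basicOpen j hj f⟩
  have h₀ : (U₀.1 : Set X.carrier) = {j.hom.base (empty A)} := by
    change j.hom.base '' (basicOpen f : Set (MonoidSpectrum A)) = _
    rw [hf]
    exact Set.image_singleton
  refine ⟨U₀, ?_⟩
  have : x ∈ (U₀.1 : Set X.carrier) := hx U₀.1 (affineOpen_nonempty U₀)
  rw [h₀] at this
  rw [h₀, this]

theorem exists_genericPoint [ConnectedSpace X.carrier] (hft : X.IsOfFiniteType) :
    ∃ x : X.carrier, IsGenericPoint x Set.univ ∧ (∀ U : X.AffineOpens, x ∈ U.1) ∧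
      ∃ U₀ : X.AffineOpens, (U₀.1 : Set X.carrier) = {x} := by
  obtain ⟨x, hx⟩ := exists_mem_of_nonempty (X := X)
  obtain ⟨n, U, hU, hcov⟩ := hft.exists_cover
  obtain ⟨V, -⟩ := exists_affineOpen x
  obtain ⟨i, -⟩ := hcov V
  refine ⟨x, ?_, fun U => hx U.1 (affineOpen_nonempty U), ?_⟩
  · refine Set.eq_univ_of_forall fun y => ?_
    rw [mem_closure_iff]
    intro W hW hy
    exact ⟨x, hx ⟨W, hW⟩ ⟨y, hy⟩, rfl⟩
  · exact exists_affineOpen_eq_singleton hx (U i) (hU i)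

/-! ### The stalk at an open generic point is a group of fractions -/

section GenericStalk

variable {x : X.carrier} {U₀ : X.AffineOpens}

theorem le_of_eq_singleton (hU₀ : (U₀.1 : Set X.carrier) = {x}) {U : X.AffineOpens}
    (hU : x ∈ U.1) : U₀ ≤ U := by
  intro y hy
  have : y ∈ (U₀.1 : Set X.carrier) := hy
  rw [hU₀, Set.mem_singleton_iff] at this
  exact this ▸ hU

theorem mem_of_eq_singleton (hU₀ : (U₀.1 : Set X.carrier) = {x}) : x ∈ U₀.1 := by
  have : x ∈ (U₀.1 : Set X.carrier) := hU₀ ▸ rfl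
  exact this

theorem toStalk_injective (hX : X.IsIntegral) (hU₀ : (U₀.1 : Set X.carrier) = {x})
    (U : X.AffineOpens) (hU : x ∈ U.1) : Function.Injective (X.toStalk U.1 x hU) := by
  intro s t h
  have hle := le_of_eq_singleton hU₀ hU
  have hx := mem_of_eq_singleton hU₀
  rw [← toStalk_res hle hx, ← toStalk_res hle hx] at h
  exact res_injective hX hle ((bijective_toStalk hU₀ hx).1 h)

/-- The stalk is the monoid of sections over `U₀ = {x}`, and restriction from `U` to `U₀` is a
localization. -/
theorem exists_mul_toStalk_eq (hU₀ : (U₀.1 : Set X.carrier) = {x})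
    (U : X.AffineOpens) (hU : x ∈ U.1) (g : X.stalk x) :
    ∃ s t, g * X.toStalk U.1 x hU t = X.toStalk U.1 x hU s := by
  have hle := le_of_eq_singleton hU₀ hU
  have hx := mem_of_eq_singleton hU₀
  obtain ⟨z, rfl⟩ := (bijective_toStalk hU₀ hx).2 g
  obtain ⟨f, hf⟩ := exists_isLocalizationMap_res hle
  obtain ⟨⟨s, t⟩, hst⟩ := hf.surj z
  refine ⟨s, t, ?_⟩
  rw [← toStalk_res hle hx, ← toStalk_res hle hx, ← map_mul]
  exact congrArg _ hst

theorem isUnit_stalk (hU₀ : (U₀.1 : Set X.carrier) = {x}) (g : X.stalk x) : IsUnit g := by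
  have hx := mem_of_eq_singleton hU₀
  obtain ⟨z, rfl⟩ := (bijective_toStalk hU₀ hx).2 g
  refine (isUnit_of_subsingleton_affineOpen U₀ ?_ z).map _
  rw [hU₀]
  exact Set.subsingleton_singleton

end GenericStalk

end MonoidScheme

/-- A group of fractions of a finitely generated commutative monoid is the product of a free group
of finite rank and a finite group. -/
theorem exists_mulEquiv_of_fraction {A G : Type} [CommMonoid A] [CommMonoid G] [Monoid.FG A]
    (hG : ∀ g : G, IsUnit g) (φ : A →* G) (hφ : ∀ g, ∃ s t, g * φ t = φ s) :
    ∃ (r : ℕ) (F : Type) (_ : CommGroup F) (_ : Finite F),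
      Nonempty (G ≃* Multiplicative (Fin r → ℤ) × F) := by
  let _ : CommGroup G := commGroupOfIsUnit hG
  have : Group.FG G := by
    obtain ⟨S, hS, hfin⟩ := Monoid.fg_iff.mp ‹Monoid.FG A›
    refine Group.fg_iff.mpr ⟨φ '' S, top_le_iff.mp fun g _ => ?_, hfin.image φ⟩
    have h : ∀ a, φ a ∈ Subgroup.closure (φ '' S) := by
      have : Submonoid.closure S ≤ (Subgroup.closure (φ '' S)).toSubmonoid.comap φ :=
        Submonoid.closure_le.mpr fun a ha => Subgroup.subset_closure ⟨a, ha, rfl⟩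
      exact fun a => this (hS ▸ Submonoid.mem_top a)
    obtain ⟨s, t, hst⟩ := hφ g
    rw [eq_mul_inv_of_mul_eq hst]
    exact mul_mem (h s) (inv_mem (h t))
  obtain ⟨i, j, _, _, p, hp, e, ⟨f⟩⟩ := CommGroup.equiv_free_prod_prod_multiplicative_zmod G
  -- Nonzero moduli make the factors `ZMod (p a ^ e a)`, and hence the torsion part, finite.
  have : ∀ a, NeZero (p a ^ e a) := fun a => ⟨pow_ne_zero _ (hp a).ne_zero⟩
  let c := Fintype.equivFin j
  let g : (j → Multiplicative ℤ) ≃* Multiplicative (Fin (Fintype.card j) → ℤ) :=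
    { toFun := fun x => Multiplicative.ofAdd fun a => (x (c.symm a)).toAdd
      invFun := fun y a => Multiplicative.ofAdd (y.toAdd (c a))
      left_inv := fun x => by simp
      right_inv := fun y => by simp
      map_mul' := fun x y => rfl }
  exact ⟨_, _, inferInstance, inferInstanceAs (Finite (∀ a, ZMod (p a ^ e a))),
    ⟨f.trans (g.prodCongr (MulEquiv.refl _))⟩⟩

end FOne

namespace FOne

open CartesianMonoidalCategory MonObj

/-! ### Points of `Spec k[A]` as homomorphisms out of `A` -/

section Points

variable {k : CommRingCat.{u}} {A B : Type u} [CommMonoid A] [CommMonoid B]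

instance isMonHom_diagMap (φ : A →* B) : IsMonHom (diagMap k φ) :=
  ((bialgSpec k).map (CommBialgCat.ofHom (MonoidAlgebra.mapDomainBialgHom k φ)).op).isMonHom_hom

instance : IsCommMonObj (diag k A) :=
  inferInstanceAs (IsCommMonObj ((Spec (CommRingCat.of (MonoidAlgebra k A))).asOver (Spec k)))

end Points

section Points

variable {k : Type u} [CommRing k] {A B T : Type u} [CommMonoid A] [CommMonoid B]
  [CommRing T] [Algebra k T]

/-- The spectrum of a `k`-algebra as a scheme over `Spec k`. -/
abbrev specOver (k T : Type u) [CommRing k] [CommRing T] [Algebra k T] :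
    Over (Spec (CommRingCat.of k)) :=
  (Spec (CommRingCat.of T)).asOver (Spec (CommRingCat.of k))

/-- The `T`-valued point of `Spec k[A]` that corresponds to a homomorphism `A → T`. -/
def point (ρ : A →* T) : specOver k T ⟶ diag (CommRingCat.of k) A :=
  Spec.mapMulEquiv ⟨MonoidAlgebra.lift k T A ρ⟩

theorem point_left (ρ : A →* T) : (point (k := k) ρ).left =
    Spec.map (CommRingCat.ofHom (MonoidAlgebra.lift k T A ρ).toRingHom) := rfl

/-- The comultiplication is `a ↦ a ⊗ a`, so convolution of algebra homomorphisms is the pointwise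
product on elements of `A`. -/
theorem point_mul (ρ σ : A →* T) : point (k := k) (ρ * σ) = point ρ * point σ := by
  refine Eq.trans (congrArg Spec.mapMulEquiv ?_) (Spec.mapMulEquiv.map_mul _ _)
  apply WithConv.ofConv_injective
  refine MonoidAlgebra.algHom_ext (fun a => ?_) (Subsingleton.elim _ _)
  simp [AlgHom.convMul_def]

theorem point_one : point (k := k) (1 : A →* T) = 1 := by
  refine Eq.trans (congrArg Spec.mapMulEquiv ?_) (map_one Spec.mapMulEquiv)
  apply WithConv.ofConv_injective
  refine MonoidAlgebra.algHom_ext (fun a => ?_) (Subsingleton.elim _ _)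
  simp [AlgHom.convOne_def]

theorem point_diagMap (φ : A →* B) (ρ : B →* T) :
    point (k := k) ρ ≫ diagMap _ φ = point (ρ.comp φ) := by
  apply Over.OverMorphism.ext
  rw [Over.comp_left, point_left, diagMap_left, point_left]
  refine (Spec.map_comp _ _).symm.trans ?_
  rw [← CommRingCat.ofHom_comp]
  congr 2
  apply MonoidAlgebra.ringHom_ext
  · intro r
    simp
  · intro a
    simp

/-- The `k`-valued point of `Spec k[A]` that corresponds to a homomorphism `A → k`. -/
def basePoint (χ : A →* k) : 𝟙_ (Over (Spec (CommRingCat.of k))) ⟶ diag (CommRingCat.of k) A :=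
  Over.homMk (Spec.map (CommRingCat.ofHom (MonoidAlgebra.lift k k A χ).toRingHom)) (by
    change Spec.map _ ≫ Spec.map (CommRingCat.ofHom (algebraMap k (MonoidAlgebra k A))) = 𝟙 _
    rw [← Spec.map_comp, ← CommRingCat.ofHom_comp]
    refine (congrArg (fun t => Spec.map (CommRingCat.ofHom t)) ?_).trans (Spec.map_id _)
    apply RingHom.ext
    intro x
    simp)

theorem toUnit_basePoint (χ : A →* k) : toUnit (specOver k T) ≫ basePoint χ =
    point (((algebraMap k T : k →+* T) : k →* T).comp χ) := by
  apply Over.OverMorphism.ext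
  refine (Spec.map_comp _ _).symm.trans (congrArg Spec.map ?_)
  rw [← CommRingCat.ofHom_comp]
  congr 1
  apply MonoidAlgebra.ringHom_ext
  · intro r
    simp [Algebra.algebraMap_eq_smul_one]
  · intro a
    simp

theorem basePoint_diagMap (φ : A →* B) (χ : B →* k) :
    basePoint χ ≫ diagMap _ φ = basePoint (χ.comp φ) := by
  apply Over.OverMorphism.ext
  refine (Spec.map_comp _ _).symm.trans (congrArg Spec.map ?_)
  rw [← CommRingCat.ofHom_comp]
  congr 1
  apply MonoidAlgebra.ringHom_ext
  · intro r
    simp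
  · intro a
    simp

instance : IsIso (toUnit (specOver k k)) := by
  have : IsIso ((Over.forget _).map (toUnit (specOver k k))) := by
    change IsIso (Spec.map (CommRingCat.ofHom (algebraMap k k)))
    rw [show CommRingCat.ofHom (algebraMap k k) = 𝟙 _ from rfl, Spec.map_id]
    infer_instance
  exact isIso_of_reflects_iso _ (Over.forget _)

theorem basePoint_mul (χ ψ : A →* k) : basePoint (χ * ψ) = basePoint χ * basePoint ψ := by
  rw [← cancel_epi (toUnit (specOver k k)), MonObj.comp_mul, toUnit_basePoint, toUnit_basePoint,
    toUnit_basePoint, ← point_mul]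
  rfl

theorem basePoint_one : basePoint (1 : A →* k) = 1 := by
  rw [← cancel_epi (toUnit (specOver k k)), toUnit_basePoint]
  exact (point_one (A := A)).trans (MonObj.comp_one _).symm

end Points

/-! ### Decomposition of `Spec k[N × F]` by the characters of `F` -/

section Decomposition

variable {k : Type u} [Field k] {G N F : Type u} [CommMonoid G] [CommMonoid N] [CommGroup F]
  (e : G ≃* N × F)

/-- The homomorphism `G → k[N]` that sends `(n, f)` to `χ(f) · n`. -/
def twist (χ : F →* kˣ) : G →* MonoidAlgebra k N :=
  (MonoidAlgebra.of k N).comp ((MonoidHom.fst N F).comp e.toMonoidHom) *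
    ((algebraMap k (MonoidAlgebra k N) : k →+* _) : k →* _).comp
      (((Units.coeHom k).comp χ).comp ((MonoidHom.snd N F).comp e.toMonoidHom))

theorem twist_apply (χ : F →* kˣ) (n : N) (f : F) :
    twist e χ (e.symm (n, f)) = MonoidAlgebra.single n (χ f : k) := by
  simp [twist, MonoidAlgebra.single_mul_single]

/-- The algebra homomorphism `k[G] → k[N]` that sends `(n, f)` to `χ(f) · n`. -/
def twistHom (χ : F →* kˣ) : MonoidAlgebra k G →ₐ[k] MonoidAlgebra k N :=
  MonoidAlgebra.lift k _ G (twist e χ)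

theorem twistHom_single (χ : F →* kˣ) (n : N) (f : F) (c : k) :
    twistHom e χ (MonoidAlgebra.single (e.symm (n, f)) c) =
      MonoidAlgebra.single n (c * (χ f : k)) := by
  rw [twistHom, MonoidAlgebra.lift_single, twist_apply]
  simp

theorem twistHom_surjective (χ : F →* kˣ) : Function.Surjective (twistHom e χ) := by
  intro x
  induction x using MonoidAlgebra.induction_linear with
  | zero => exact ⟨0, map_zero _⟩
  | add x y hx hy =>
    obtain ⟨x, rfl⟩ := hx
    obtain ⟨y, rfl⟩ := hy
    exact ⟨x + y, map_add _ _ _⟩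
  | single n c =>
    refine ⟨MonoidAlgebra.single (e.symm (n, 1)) c, ?_⟩
    rw [twistHom_single]
    simp

theorem sub_mem_of_mem_range {χ : F →* kˣ} {P : PrimeSpectrum (MonoidAlgebra k G)}
    (hP : P ∈ Set.range (PrimeSpectrum.comap (twistHom e χ).toRingHom)) (f : F) :
    MonoidAlgebra.single (e.symm (1, f)) 1 - algebraMap k (MonoidAlgebra k G) (χ f) ∈
      P.asIdeal := by
  obtain ⟨Q, rfl⟩ := hP
  rw [PrimeSpectrum.comap_asIdeal, Ideal.mem_comap]
  have : (twistHom e χ) (MonoidAlgebra.single (e.symm (1, f)) 1 -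
      algebraMap k (MonoidAlgebra k G) (χ f)) = 0 := by
    rw [map_sub, twistHom_single, AlgHom.commutes]
    simp
  exact this ▸ Q.asIdeal.zero_mem

theorem eq_of_algebraMap_sub_mem {R : Type u} [CommRing R] [Algebra k R] {P : PrimeSpectrum R}
    {x : R} {c d : k} (hc : x - algebraMap k R c ∈ P.asIdeal)
    (hd : x - algebraMap k R d ∈ P.asIdeal) : c = d := by
  by_contra hne
  have h := P.asIdeal.sub_mem hd hc
  rw [sub_sub_sub_cancel_left, ← map_sub] at h
  exact P.isPrime.ne_top (Ideal.eq_top_of_isUnit_mem _ h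
    ((sub_ne_zero.mpr hne).isUnit.map (algebraMap k R)))

/-- Pieces for different characters are disjoint: in the residue ring at `P` each `f` would equal
both scalars `χ f` and `ψ f`, and distinct scalars differ by a unit. -/
theorem eq_of_mem_range {χ ψ : F →* kˣ} {P : PrimeSpectrum (MonoidAlgebra k G)}
    (hχ : P ∈ Set.range (PrimeSpectrum.comap (twistHom e χ).toRingHom))
    (hψ : P ∈ Set.range (PrimeSpectrum.comap (twistHom e ψ).toRingHom)) : χ = ψ := by
  ext f
  exact eq_of_algebraMap_sub_mem (sub_mem_of_mem_range e hχ f) (sub_mem_of_mem_range e hψ f)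

/-- The polynomial `Xⁿ - 1` splits over `k`, so a product of factors `x - c` vanishes and the prime
contains one of them; `cⁿ = 1` makes `c` a unit. -/
theorem exists_root_sub_mem [IsAlgClosed k] {R : Type u} [CommRing R] [Algebra k R]
    (P : PrimeSpectrum R) {x : R} {n : ℕ} (hn : 0 < n) (hx : x ^ n = 1) :
    ∃ c : kˣ, x - algebraMap k R c ∈ P.asIdeal := by
  let p : Polynomial k := Polynomial.X ^ n - 1
  have hp : p.Monic := Polynomial.monic_X_pow_sub_C 1 hn.ne'
  have hs : p.Splits := IsAlgClosed.splits p
  have hprod := hs.eq_prod_roots_of_monic hp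
  have h0 : Polynomial.aeval x p = 0 := by simp [p, hx]
  rw [hprod, map_multiset_prod, Multiset.map_map] at h0
  have hmem : (p.roots.map (Polynomial.aeval x ∘ fun a => Polynomial.X - Polynomial.C a)).prod ∈
      P.asIdeal := h0 ▸ P.asIdeal.zero_mem
  obtain ⟨q, hq, hqP⟩ := (Ideal.IsPrime.multiset_prod_mem_iff_exists_mem P.isPrime _).mp hmem
  obtain ⟨c, hc, rfl⟩ := Multiset.mem_map.mp hq
  have hroot : c ^ n = 1 := by
    have := (Polynomial.mem_roots'.mp hc).2
    simpa [p, sub_eq_zero] using this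
  refine ⟨Units.ofPowEqOne c n hroot hn.ne', ?_⟩
  simpa using hqP

/-- Modulo `P` every `f` is congruent to a scalar, because `f` has finite order. The scalar is
unique, hence multiplicative in `f`. -/
theorem exists_mem_range [IsAlgClosed k] [Finite F] (P : PrimeSpectrum (MonoidAlgebra k G)) :
    ∃ χ : F →* kˣ, P ∈ Set.range (PrimeSpectrum.comap (twistHom e χ).toRingHom) := by
  let incl : F →* MonoidAlgebra k G :=
    (MonoidAlgebra.of k G).comp (e.symm.toMonoidHom.comp (MonoidHom.inr N F))
  have h : ∀ f : F, ∃ c : kˣ, incl f - algebraMap k _ (c : k) ∈ P.asIdeal := fun f =>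
    exists_root_sub_mem P (Nat.card_pos (α := F)) (by rw [← map_pow, pow_card_eq_one', map_one])
  choose c hc using h
  let q := Ideal.Quotient.mk P.asIdeal
  have hq : ∀ f, q (incl f) = q (algebraMap k _ (c f : k)) := fun f => Ideal.Quotient.eq.mpr (hc f)
  let χ : F →* kˣ :=
    { toFun := c
      map_one' := by
        ext
        refine eq_of_algebraMap_sub_mem (hc 1) ?_
        simp [← MonoidAlgebra.one_def]
      map_mul' := by
        intro f g
        ext
        refine eq_of_algebraMap_sub_mem (hc (f * g)) (Ideal.Quotient.eq.mp ?_)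
        change q _ = q _
        rw [Units.val_mul, map_mul, map_mul, map_mul, map_mul, hq, hq] }
  let s : MonoidAlgebra k N →+* MonoidAlgebra k G :=
    MonoidAlgebra.mapDomainRingHom k (e.symm.toMonoidHom.comp (MonoidHom.inl N F))
  -- Modulo `P`, replacing `(n, f)` by `χ(f) · (n, 1)` changes nothing. So `q` factors through
  -- `twistHom`, and `P` is the preimage of the kernel of `q ∘ s`.
  have hs : q.comp (s.comp (twistHom e χ).toRingHom) = q := by
    apply MonoidAlgebra.ringHom_ext
    · intro r
      have h1 := twistHom_single e χ 1 1 r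
      rw [show ((1 : N), (1 : F)) = 1 from rfl, map_one e.symm] at h1
      change q (s (twistHom e χ _)) = _
      rw [h1]
      simp [s, show ((1 : N), (1 : F)) = 1 from rfl]
    · intro g
      obtain ⟨⟨n, f⟩, rfl⟩ := e.symm.surjective g
      change q (s (twistHom e χ _)) = _
      rw [twistHom_single]
      have h1 : (MonoidAlgebra.single (e.symm (n, f)) 1 : MonoidAlgebra k G) =
          MonoidAlgebra.single (e.symm (n, 1)) 1 * incl f := by
        simp [incl, MonoidAlgebra.single_mul_single, ← map_mul]
      rw [h1, map_mul, hq, ← map_mul]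
      simp [s, χ, MonoidAlgebra.single_mul_single]
  refine ⟨χ, PrimeSpectrum.comap (q.comp s) ⟨⊥, Ideal.isPrime_bot⟩, ?_⟩
  apply PrimeSpectrum.ext
  change Ideal.comap (twistHom e χ).toRingHom (Ideal.comap (q.comp s) ⊥) = _
  rw [Ideal.comap_comap, RingHom.comp_assoc, hs]
  exact Ideal.mk_ker

/-- The pieces are closed, as images of spectra under surjective ring homomorphisms. Finitely many
of them partition the spectrum, so each is also open. -/
theorem isOpen_range_comap_twistHom [IsAlgClosed k] [Finite F] [Finite (F →* kˣ)] (χ : F →* kˣ) :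
    IsOpen (Set.range (PrimeSpectrum.comap (twistHom e χ).toRingHom)) := by
  have h : (Set.range (PrimeSpectrum.comap (twistHom e χ).toRingHom))ᶜ =
      ⋃ ψ : {ψ : F →* kˣ // ψ ≠ χ}, Set.range (PrimeSpectrum.comap (twistHom e ψ.1).toRingHom) := by
    ext P
    rw [Set.mem_compl_iff, Set.mem_iUnion]
    constructor
    · intro hP
      obtain ⟨ψ, hψ⟩ := exists_mem_range e P
      exact ⟨⟨ψ, fun h => hP (h ▸ hψ)⟩, hψ⟩
    · rintro ⟨⟨ψ, hne⟩, hψ⟩ hχ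
      exact hne (eq_of_mem_range e hψ hχ)
  rw [← isClosed_compl_iff, h]
  exact isClosed_iUnion_of_finite fun ψ =>
    PrimeSpectrum.isClosed_range_comap_of_surjective _ _ (twistHom_surjective e ψ.1)

end Decomposition

end FOne

namespace FOne
-- The canonical action on the base change
namespace MonoidScheme

open CartesianMonoidalCategory

variable (X : MonoidScheme.{u}) (k : CommRingCat.{u})

theorem isOpenImmersion_chart_left (U : X.AffineOpens) : IsOpenImmersion (X.chart k U).left :=
  isOpenImmersion_colimitι_left (X.baseChangeDiagram k) U

theorem exists_chart_left_apply_eq (y : (X.baseChange k).left) :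
    ∃ (U : X.AffineOpens) (z : (diag k (X.presheaf.obj (op U.1))).left), (X.chart k U).left z = y :=
  exists_colimitι_left_apply_eq (X.baseChangeDiagram k) y

variable {X} in
theorem diagMap_res_chart {U V : X.AffineOpens} (h : U ≤ V) :
    diagMap k (X.res h) ≫ X.chart k V = X.chart k U :=
  Limits.colimit.w (X.baseChangeDiagram k) (homOfLE h)

variable {X} {k} in
theorem exists_of_chart_left_apply_eq {U V : X.AffineOpens}
    {y : (diag k (X.presheaf.obj (op U.1))).left} {z : (diag k (X.presheaf.obj (op V.1))).left}
    (h : (X.chart k U).left y = (X.chart k V).left z) :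
    ∃ (W : X.AffineOpens) (hU : W ≤ U) (hV : W ≤ V)
      (w : (diag k (X.presheaf.obj (op W.1))).left), (diagMap k (X.res hU)).left w = y ∧
        (diagMap k (X.res hV)).left w = z := by
  obtain ⟨W, f, g, w, hw⟩ := exists_of_colimitι_left_apply_eq (X.baseChangeDiagram k) h
  exact ⟨W, f.le, g.le, w, hw⟩

variable {x : X.carrier}

/-- The action of `Spec k[G]` on `Spec k[A]` for a homomorphism `A → G`. -/
def actionMap {A G : Type u} [CommMonoid A] [CommMonoid G] (φ : A →* G) :
    diag k G ⊗ diag k A ⟶ diag k A :=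
  (diagMap k φ ▷ diag k A) ≫ MonObj.mul

theorem one_actionMap {A G : Type u} [CommMonoid A] [CommMonoid G] (φ : A →* G) :
    MonObj.one ▷ diag k A ≫ actionMap k φ = (λ_ _).hom := by
  rw [actionMap, ← comp_whiskerRight_assoc, IsMonHom.one_hom, MonObj.one_mul]

theorem mul_actionMap {A G : Type u} [CommMonoid A] [CommMonoid G] (φ : A →* G) :
    MonObj.mul ▷ diag k A ≫ actionMap k φ =
      (α_ _ _ _).hom ≫ diag k G ◁ actionMap k φ ≫ actionMap k φ := by
  rw [actionMap, ← comp_whiskerRight_assoc, IsMonHom.mul_hom, comp_whiskerRight_assoc,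
    MonObj.mul_assoc, MonoidalCategory.whiskerLeft_comp, MonoidalCategory.tensorHom_def]
  simp only [Category.assoc, comp_whiskerRight, whisker_exchange_assoc]
  simp

/-- Equivariance of `diagMap k φ`, from its being a homomorphism of monoid objects. It gives both
the compatibility of the chart actions with restriction and the description of the action on `Spec
k[G]`. -/
theorem whiskerLeft_actionMap {A B G : Type u} [CommMonoid A] [CommMonoid B] [CommMonoid G]
    (φ : A →* B) (ψ : B →* G) :
    diag k G ◁ diagMap k φ ≫ actionMap k (ψ.comp φ) = actionMap k ψ ≫ diagMap k φ := by
  rw [actionMap, actionMap, Category.assoc, IsMonHom.mul_hom, diagMap_comp,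
    MonoidalCategory.tensorHom_def', comp_whiskerRight]
  simp only [Category.assoc]
  rw [whisker_exchange_assoc]

variable {X}

theorem exists_action (hx : ∀ U : X.AffineOpens, x ∈ U.1) :
    ∃ s : diag k (X.stalk x) ⊗ X.baseChange k ⟶ X.baseChange k,
    ∀ U, diag k (X.stalk x) ◁ X.chart k U ≫ s =
      actionMap k (X.toStalk U.1 x (hx U)) ≫ X.chart k U := by
  have hres : ∀ {U V : X.AffineOpens} (h : U ≤ V),
      diag k (X.stalk x) ◁ diagMap k (X.res h) ≫
        actionMap k (X.toStalk V.1 x (hx V)) ≫ X.chart k V =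
      actionMap k (X.toStalk U.1 x (hx U)) ≫ X.chart k U := by
    intro U V h
    have hφ : X.toStalk V.1 x (hx V) = (X.toStalk U.1 x (hx U)).comp (X.res h) :=
      MonoidHom.ext fun s => (toStalk_res h (hx U) s).symm
    rw [hφ, ← Category.assoc, whiskerLeft_actionMap, Category.assoc, diagMap_res_chart]
  refine exists_tensor_glue _ (X.chart k) (X.isOpenImmersion_chart_left k)
    (X.exists_chart_left_apply_eq k) _ fun U V y z hyz => ?_
  obtain ⟨W, hU, hV, w, hw, -⟩ := exists_of_chart_left_apply_eq hyz
  exact ⟨W, diagMap k (X.res hU), diagMap k (X.res hV), w, hw, diagMap_res_chart k hU,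
    diagMap_res_chart k hV, hres hU, hres hV⟩

theorem baseChange_hom_ext {M : Over (Spec k)} {Y : Over (Spec k)} {f g : M ⊗ X.baseChange k ⟶ Y}
    (h : ∀ U, M ◁ X.chart k U ≫ f = M ◁ X.chart k U ≫ g) : f = g :=
  tensor_hom_ext M (X.chart k) (X.isOpenImmersion_chart_left k) (X.exists_chart_left_apply_eq k) h

theorem exists_isCanonicalAction (hx : ∀ U : X.AffineOpens, x ∈ U.1) :
    ∃ a : ModObj (diag k (X.stalk x)) (X.baseChange k), X.IsCanonicalAction k x a := by
  obtain ⟨s, hs⟩ := exists_action k hx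
  refine ⟨⟨s, ?_, ?_⟩, fun U h => (hs U).trans (Category.assoc _ _ _)⟩
  -- Both action axioms may be tested on charts, where they are `one_actionMap` and `mul_actionMap`.
  · refine baseChange_hom_ext k fun U => ?_
    change _ ◁ _ ≫ MonObj.one ▷ _ ≫ s = _ ◁ _ ≫ (λ_ _).hom
    rw [whisker_exchange_assoc, hs, leftUnitor_naturality, ← Category.assoc]
    rw [one_actionMap]
  · refine baseChange_hom_ext k fun U => ?_
    change _ ◁ _ ≫ MonObj.mul ▷ _ ≫ s = _ ◁ _ ≫ (α_ _ _ _).hom ≫ _ ◁ s ≫ s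
    rw [whisker_exchange_assoc, hs, associator_naturality_right_assoc, ← whiskerLeft_comp_assoc, hs,
      whiskerLeft_comp_assoc, hs, ← Category.assoc, ← Category.assoc, ← Category.assoc]
    rw [mul_actionMap]
    simp only [Category.assoc]

/-- The inclusion of `Spec k[G]` into the base change, where `G` is the stalk at the point `x`. -/
def stalkChart (U : X.AffineOpens) (hU : x ∈ U.1) : diag k (X.stalk x) ⟶ X.baseChange k :=
  diagMap k (X.toStalk U.1 x hU) ≫ X.chart k U

theorem stalkChart_eq {U V : X.AffineOpens} (h : U ≤ V) (hU : x ∈ U.1) :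
    X.stalkChart k U hU = X.stalkChart k V (h hU) := by
  have hφ : X.toStalk V.1 x (h hU) = (X.toStalk U.1 x hU).comp (X.res h) :=
    MonoidHom.ext fun s => (toStalk_res h hU s).symm
  rw [stalkChart, stalkChart, hφ, diagMap_comp, Category.assoc, diagMap_res_chart]

/-- Over the open point `{x}` the map to the stalk is bijective, so this inclusion is a chart up to
isomorphism. -/
theorem isOpenImmersion_stalkChart_left {U : X.AffineOpens}
    (hU : (U.1 : Set X.carrier) = {x}) (hx : x ∈ U.1) :
    IsOpenImmersion (X.stalkChart k U hx).left := by
  let e := MulEquiv.ofBijective (X.toStalk U.1 x hx) (bijective_toStalk hU hx)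
  have h₁ : diagMap k (X.toStalk U.1 x hx) ≫ diagMap k e.symm.toMonoidHom = 𝟙 _ := by
    rw [← diagMap_comp, ← diagMap_id]
    congr 1
    exact MonoidHom.ext e.apply_symm_apply
  have h₂ : diagMap k e.symm.toMonoidHom ≫ diagMap k (X.toStalk U.1 x hx) = 𝟙 _ := by
    rw [← diagMap_comp, ← diagMap_id]
    congr 1
    exact MonoidHom.ext e.symm_apply_apply
  have : IsIso (diagMap k (X.toStalk U.1 x hx)) := ⟨_, h₁, h₂⟩
  have : IsIso (diagMap k (X.toStalk U.1 x hx)).left :=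
    inferInstanceAs (IsIso ((Over.forget _).map (diagMap k (X.toStalk U.1 x hx))))
  have := X.isOpenImmersion_chart_left k U
  rw [stalkChart, Over.comp_left]
  infer_instance

theorem whiskerLeft_stalkChart {a : ModObj (diag k (X.stalk x)) (X.baseChange k)}
    (ha : X.IsCanonicalAction k x a) (U : X.AffineOpens) (hU : x ∈ U.1) :
    diag k (X.stalk x) ◁ X.stalkChart k U hU ≫ a.smul = MonObj.mul ≫ X.stalkChart k U hU := by
  -- With the identity of `G` as second homomorphism, the action of `Spec k[G]` on itself is
  -- multiplication.
  have h := whiskerLeft_actionMap k (X.toStalk U.1 x hU) (MonoidHom.id _)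
  rw [actionMap, actionMap, diagMap_id, id_whiskerRight, Category.id_comp, MonoidHom.id_comp] at h
  have hU' := ha U hU
  rw [stalkChart, MonoidalCategory.whiskerLeft_comp, Category.assoc, hU',
    ← Category.assoc MonObj.mul (diagMap k _),
    ← h]
  simp only [Category.assoc]

end MonoidScheme

theorem denseRange_diagMap_left {k : CommRingCat.{u}} {A B : Type u} [CommMonoid A] [CommMonoid B]
    {φ : A →* B} (h : Function.Injective φ) : DenseRange (diagMap k φ).left := by
  change DenseRange (PrimeSpectrum.comap (MonoidAlgebra.mapDomainRingHom k φ))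
  rw [PrimeSpectrum.denseRange_comap_iff_ker_le_nilRadical,
    (RingHom.injective_iff_ker_eq_bot _).mp (MonoidAlgebra.mapDomain_injective h)]
  exact bot_le

namespace MonoidScheme

variable {X : MonoidScheme.{u}} (k : CommRingCat.{u}) {x : X.carrier}

/-- The inclusion of `Spec k[G]` factors through every chart `Spec k[A]`, where its image is dense
because `k[A] → k[G]` is injective. -/
theorem denseRange_stalkChart_left (hX : X.IsIntegral) {U : X.AffineOpens}
    (hU : (U.1 : Set X.carrier) = {x}) (hx : ∀ U : X.AffineOpens, x ∈ U.1) :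
    DenseRange (X.stalkChart k U (hx U)).left := by
  intro y
  obtain ⟨V, z, rfl⟩ := X.exists_chart_left_apply_eq k y
  rw [stalkChart_eq k (le_of_eq_singleton hU (hx V)) (hx U), stalkChart, Over.comp_left]
  have hz := denseRange_diagMap_left (k := k) (toStalk_injective hX hU V (hx V)) z
  have := image_closure_subset_closure_image (X.chart k V).left.continuous ⟨z, hz, rfl⟩
  refine closure_mono ?_ this
  rintro _ ⟨_, ⟨w, rfl⟩, rfl⟩
  exact ⟨w, Scheme.Hom.comp_apply _ _ _⟩

theorem baseChange_finiteType (hX : X.IsOfFiniteType) :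
    LocallyOfFiniteType (X.baseChange k).hom ∧ QuasiCompact (X.baseChange k).hom := by
  obtain ⟨n, U, hU, hcov⟩ := hX.exists_cover
  have hs : ∀ y : (X.baseChange k).left, ∃ i z, (X.chart k (U i)).left z = y := by
    intro y
    obtain ⟨V, z, rfl⟩ := X.exists_chart_left_apply_eq k y
    obtain ⟨i, hi⟩ := hcov V
    refine ⟨i, (diagMap k (X.res hi)).left z, ?_⟩
    rw [← diagMap_res_chart k hi, Over.comp_left, Scheme.Hom.comp_apply]
  constructor
  · let 𝒰 := openCoverOfSurjective (J := ULift.{u} (Fin n)) (fun i => (X.chart k (U i.down)).left)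
      (fun i => X.isOpenImmersion_chart_left k (U i.down))
      (fun y => ⟨⟨(hs y).choose⟩, (hs y).choose_spec⟩)
    have : IsZariskiLocalAtSource @LocallyOfFiniteType :=
      HasRingHomProperty.instIsZariskiLocalAtSource (Q := RingHom.FiniteType)
    refine (IsZariskiLocalAtSource.iff_of_openCover 𝒰).mpr fun i => ?_
    change LocallyOfFiniteType ((X.chart k (U i.down)).left ≫ (X.baseChange k).hom)
    rw [Over.w]
    have := hU i.down
    exact inferInstanceAs (LocallyOfFiniteType
      (Spec (CommRingCat.of (MonoidAlgebra k (X.presheaf.obj (op (U i.down).1)))) ↘ Spec k))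
  · have : CompactSpace (X.baseChange k).left := by
      refine ⟨?_⟩
      have h : (Set.univ : Set (X.baseChange k).left) =
          ⋃ i, Set.range (X.chart k (U i)).left := by
        refine (Set.eq_univ_of_forall fun y => ?_).symm
        obtain ⟨i, z, hz⟩ := hs y
        exact Set.mem_iUnion.mpr ⟨i, z, hz⟩
      rw [h]
      exact isCompact_iUnion fun i => by
        have : CompactSpace (diag k (X.presheaf.obj (op (U i).1))).left :=
          inferInstanceAs (CompactSpace (PrimeSpectrum _))
        exact isCompact_range (X.chart k (U i)).left.continuous
    exact quasiCompact_of_compactSpace _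

end MonoidScheme
end FOne

namespace FOne

open CartesianMonoidalCategory

/-! ### Irreducible components with the reduced structure -/

section Component

open AlgebraicGeometry.Scheme

variable {S : AlgebraicGeometry.Scheme.{u}}

theorem isReduced_subscheme_vanishingIdeal {W : AlgebraicGeometry.Scheme.{u}} (Z : Closeds W) :
    IsReduced (IdealSheafData.vanishingIdeal Z).subscheme := by
  have : ∀ U, IsReduced ((IdealSheafData.vanishingIdeal Z).subschemeCover.openCover.X U) := by
    intro U
    change IsReduced (Spec (CommRingCat.of (Γ(W, U.1) ⧸ (IdealSheafData.vanishingIdeal Z).ideal U)))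
    rw [affine_isReduced_iff]
    refine (Ideal.isRadical_iff_quotient_reduced _).mp ?_
    have h := IdealSheafData.vanishingIdeal_ideal Z U
    exact h ▸ PrimeSpectrum.isRadical_vanishingIdeal _
  exact IsReduced.of_openCover _ (IdealSheafData.vanishingIdeal Z).subschemeCover.openCover

/-- The pullback of a function vanishing on `Z` vanishes at every point of `T`, so it is zero since
`T` is reduced. -/
theorem vanishingIdeal_le_ker {W T : AlgebraicGeometry.Scheme.{u}} [IsReduced T] {Z : Closeds W}
    (g : T ⟶ W) (hg : Set.range g ⊆ Z) : IdealSheafData.vanishingIdeal Z ≤ g.ker := by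
  refine IdealSheafData.le_ofIdeals_iff.mpr fun U s hs => ?_
  change (g.app U.1).hom s = 0
  rw [← basicOpen_eq_bot_iff]
  apply Opens.ext
  refine Set.eq_empty_of_forall_notMem fun x hx => ?_
  rw [← Scheme.preimage_basicOpen] at hx
  have hZ : g x ∈ (IdealSheafData.vanishingIdeal Z).support :=
    IdealSheafData.le_support_iff_le_vanishingIdeal.mpr le_rfl (hg ⟨x, rfl⟩)
  have hU : g x ∈ U.1 := W.basicOpen_le s hx
  exact (mem_zeroLocus_iff _ _ _).mp ((IdealSheafData.mem_support_iff_of_mem hU).mp hZ) s hs hx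

variable {Y : Over S} (Z : irreducibleComponents Y.left)

instance : IsClosedImmersion (componentι Z).left :=
  inferInstanceAs (IsClosedImmersion (IdealSheafData.vanishingIdeal
    ⟨Z.1, isClosed_of_mem_irreducibleComponents Z.1 Z.2⟩).subschemeι)

instance : Mono (componentι Z) := by
  have : Mono ((Over.forget S).map (componentι Z)) :=
    inferInstanceAs (Mono (componentι Z).left)
  exact (Over.forget S).mono_of_mono_map this

theorem range_componentι_left : Set.range (componentι Z).left = Z.1 := by
  refine (IdealSheafData.range_subschemeι _).trans ?_
  exact IdealSheafData.coe_support_vanishingIdeal _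

/-- Universal property of the reduced structure. All actions, cells and isomorphisms on components
are obtained from it by checking images of points. -/
theorem exists_comp_componentι_eq {W : Over S} [IsReduced W.left] (g : W ⟶ Y)
    (hg : Set.range g.left ⊆ Z.1) : ∃ l : W ⟶ component Z, l ≫ componentι Z = g := by
  have h : (componentι Z).left.ker ≤ g.left.ker := by
    refine (IdealSheafData.ker_subschemeι _).le.trans (vanishingIdeal_le_ker g.left ?_)
    exact hg
  have hl := IsClosedImmersion.lift_fac (componentι Z).left g.left h
  refine ⟨Over.homMk (IsClosedImmersion.lift (componentι Z).left g.left h) ?_,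
    Over.OverMorphism.ext hl⟩
  exact (Category.assoc _ _ _).symm.trans ((congrArg (· ≫ Y.hom) hl).trans (Over.w g))

instance : IsIntegral (component Z).left := by
  rw [isIntegral_iff_irreducibleSpace_and_isReduced]
  refine ⟨?_, isReduced_subscheme_vanishingIdeal _⟩
  have e := (componentι Z).left.isClosedEmbedding.isEmbedding.toHomeomorph.trans
    (Homeomorph.setCongr (range_componentι_left Z))
  have : IrreducibleSpace Z.1 := Subtype.irreducibleSpace Z.2.1
  exact e.symm.surjective.irreducibleSpace e.symm.continuous

theorem locallyOfFiniteType_component_hom [LocallyOfFiniteType Y.hom] :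
    LocallyOfFiniteType (component Z).hom :=
  inferInstanceAs (LocallyOfFiniteType ((componentι Z).left ≫ Y.hom))

theorem quasiCompact_component_hom [QuasiCompact Y.hom] : QuasiCompact (component Z).hom :=
  inferInstanceAs (QuasiCompact ((componentι Z).left ≫ Y.hom))

end Component

/-! ### Products with a torus are integral -/

section Torus

instance : ObjectProperty.IsClosedUnderIsomorphisms AlgebraicGeometry.IsIntegral where
  of_iso e h := by
    have : Nonempty _ := ⟨e.hom h.nonempty.some⟩
    exact isIntegral_of_isOpenImmersion e.inv

/-- Base change to a field `K` gives `K[ℤʳ]`, a domain. -/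
theorem geometricallyIntegral_torus (r : ℕ) : GeometricallyIntegral (torus r).hom := by
  rw [geometricallyIntegral_iff]
  refine (geometrically_iff_of_commRing_of_isClosedUnderIsomorphisms (R := ℂ)).mpr ?_
  intro K _ _
  let N := Multiplicative (Fin r → ℤ)
  have e := pullbackSpecIso ℂ (MonoidAlgebra ℂ N) K
  have : IsDomain (TensorProduct ℂ (MonoidAlgebra ℂ N) K) :=
    ((Algebra.TensorProduct.comm ℂ _ _).toRingEquiv.trans
      (MonoidAlgebra.scalarTensorEquiv ℂ K (M := N)).toRingEquiv).toMulEquiv.isDomain _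
  exact ObjectProperty.prop_of_iso IsIntegral e.symm inferInstance

theorem isIntegral_torus_tensor (r : ℕ) (V : Over (Spec (CommRingCat.of ℂ))) [IsIntegral V.left]
    [LocallyOfFiniteType V.hom] : IsIntegral (torus r ⊗ V).left := by
  have := geometricallyIntegral_torus r
  have := LocallyOfFiniteType.isLocallyNoetherian V.hom
  exact inferInstanceAs (IsIntegral (Limits.pullback (torus r).hom V.hom))

end Torus

end FOne

namespace FOne

open CartesianMonoidalCategory MonObj

/-! ### Restricting actions to subobjects -/

section Action

universe v w

variable {C : Type w} [Category.{v} C] [CartesianMonoidalCategory C]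

theorem tensorHom_smul_eq {M N Y V : C} [MonObj M] [a : ModObj M Y] (q : N ⟶ M) (i : V ⟶ Y) :
    (q ⊗ₘ i) ≫ a.smul = (fst N V ≫ q) • (snd N V ≫ i) := by
  rw [Hom.smul_def]
  congr 1
  ext <;> simp

theorem lift_tensorHom_smul {M N Y V W : C} [MonObj M] [a : ModObj M Y] (q : N ⟶ M) (i : V ⟶ Y)
    (m : W ⟶ N) (x : W ⟶ V) : lift m x ≫ (q ⊗ₘ i) ≫ a.smul = (m ≫ q) • (x ≫ i) := by
  rw [Hom.smul_def, lift_map_assoc]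

/-- The restriction of an action to an invariant subobject, along a homomorphism of monoids. -/
theorem exists_modObj_restrict {M N Y V : C} [MonObj M] [MonObj N] (a : ModObj M Y) (q : N ⟶ M)
    [IsMonHom q] (i : V ⟶ Y) [Mono i] (s : N ⊗ V ⟶ V) (hs : s ≫ i = (q ⊗ₘ i) ≫ a.smul) :
    ∃ b : ModObj N V, b.smul = s := by
  -- On generalized points, `s` becomes the action of `q(m)` on `i(x)`. As `i` is mono, the axioms
  -- for `s` follow from those in `Y`.
  have key {W : C} (m : W ⟶ N) (x : W ⟶ V) : (lift m x ≫ s) ≫ i = (m ≫ q) • (x ≫ i) := by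
    rw [Category.assoc, hs, lift_tensorHom_smul]
  refine ⟨{ smul := s, one_smul := ?_, mul_smul := ?_ }, rfl⟩
  · change MonObj.one ▷ V ≫ s = (λ_ V).hom
    have h : (MonObj.one : 𝟙_ C ⟶ N) ▷ V =
        lift (toUnit _ ≫ (MonObj.one : 𝟙_ C ⟶ N)) (snd (𝟙_ C) V) := by
      ext
      · simp [toUnit_unique (toUnit (𝟙_ C ⊗ V)) (fst (𝟙_ C) V)]
      · simp
    rw [← cancel_mono i, h, key]
    have h1 : (toUnit (𝟙_ C ⊗ V) ≫ (MonObj.one : 𝟙_ C ⟶ N)) ≫ q = (1 : 𝟙_ C ⊗ V ⟶ M) := by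
      rw [Category.assoc, IsMonHom.one_hom]
      rfl
    rw [h1, one_smul, leftUnitor_hom]
  · change MonObj.mul ▷ V ≫ s = (α_ N N V).hom ≫ N ◁ s ≫ s
    have h1 : (MonObj.mul : N ⊗ N ⟶ N) ▷ V =
        lift ((fst (N ⊗ N) V ≫ fst N N) * (fst (N ⊗ N) V ≫ snd N N))
        (snd (N ⊗ N) V) := by
      ext
      · simp [Hom.mul_def, ← comp_lift]
      · simp
    have h2 : (α_ N N V).hom ≫ N ◁ s = lift (fst (N ⊗ N) V ≫ fst N N)
        (lift (fst (N ⊗ N) V ≫ snd N N) (snd (N ⊗ N) V) ≫ s) := by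
      ext
      · simp
      · rw [Category.assoc, whiskerLeft_snd, lift_snd, ← Category.assoc]
        congr 1
        ext <;> simp
    rw [← cancel_mono i, h1, key, ← Category.assoc, h2, key, key, MonObj.mul_comp, mul_smul]

end Action

/-! ### Translations by points -/

section Translation

variable {S : AlgebraicGeometry.Scheme.{u}} {M V : Over S} [MonObj M] (a : ModObj M V)

theorem comp_translation (m : 𝟙_ (Over S) ⟶ M) {W : Over S} (x : W ⟶ V) :
    x ≫ translation a m = (toUnit W ≫ m) • x := by
  rw [translation, ← Category.assoc, comp_lift, ← Category.assoc, comp_toUnit, Category.comp_id]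
  rfl

theorem translation_comp_translation (m n : 𝟙_ (Over S) ⟶ M) :
    translation a m ≫ translation a n = translation a (n * m) := by
  rw [← Category.id_comp (translation a m), comp_translation, comp_translation, smul_smul,
    ← MonObj.comp_mul, ← comp_translation, Category.id_comp]

theorem translation_one : translation a (1 : 𝟙_ (Over S) ⟶ M) = 𝟙 V := by
  rw [← Category.id_comp (translation a 1), comp_translation, MonObj.comp_one, one_smul]

theorem smul_comp_translation [IsCommMonObj M]
    (m : 𝟙_ (Over S) ⟶ M) {W : Over S} (x : W ⟶ M) (y : W ⟶ V) :
    (x • y) ≫ translation a m = x • (y ≫ translation a m) := by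
  rw [comp_translation, comp_translation, smul_smul, smul_smul, mul_comm]

end Translation

end FOne

namespace FOne

open CartesianMonoidalCategory MonObj

/-! ### Components from a dense finite union of irreducible sets -/

section Topology

/-- The finitely many closures cover the space, so the irreducible set `Z` lies in one of them, and
maximality gives equality. -/
theorem exists_eq_closure_of_mem_irreducibleComponents {T J : Type*} [TopologicalSpace T] [Finite J]
    (A : J → Set T) (hA : ∀ j, IsIrreducible (A j)) (hd : Dense (⋃ j, A j)) {Z : Set T}
    (hZ : Z ∈ irreducibleComponents T) : ∃ j, Z = closure (A j) := by
  have hc : ⋃ j, closure (A j) = Set.univ := by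
    rw [← closure_iUnion_of_finite]
    exact hd.closure_eq
  obtain ⟨j, hj⟩ := (isIrreducible_iff_sUnion_isClosed.mp hZ.1)
    (Set.finite_range fun j => closure (A j)).toFinset (by simp) (by
      simp [Set.sUnion_range, hc])
  obtain ⟨⟨j, rfl⟩, hj⟩ := by simpa using hj
  exact ⟨j, hj.antisymm (hZ.2 (hA j).closure hj)⟩

end Topology

/-! ### Translates of the torus by characters of `F` -/

section TwistPoint

variable {G F : Type} [CommMonoid G] [CommGroup F] {r : ℕ}
  (e : G ≃* Multiplicative (Fin r → ℤ) × F)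

/-- The homomorphism `GL₁ʳ ⟶ Spec ℂ[G]` induced by the projection of `G ≅ ℤʳ × F`. -/
abbrev torusHom : torus r ⟶ diag (.of ℂ) G :=
  diagMap (.of ℂ) ((MonoidHom.fst _ F).comp e.toMonoidHom)

/-- The `ℂ`-point of `Spec ℂ[F]` given by a character of `F`. -/
def charPoint (χ : F →* ℂˣ) : 𝟙_ (Over (Spec (CommRingCat.of ℂ))) ⟶ diag (.of ℂ) F :=
  basePoint ((Units.coeHom ℂ).comp χ)

theorem charPoint_mul (χ ψ : F →* ℂˣ) : charPoint (χ * ψ) = charPoint χ * charPoint ψ := by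
  rw [charPoint, charPoint, charPoint, ← basePoint_mul, MonoidHom.comp_mul]

theorem charPoint_one : charPoint (1 : F →* ℂˣ) = 1 :=
  (congrArg basePoint (MonoidHom.comp_one _)).trans basePoint_one

/-- The `ℂ`-point of `Spec ℂ[G]` given by a character of `F`. -/
def finitePoint (χ : F →* ℂˣ) : 𝟙_ (Over (Spec (CommRingCat.of ℂ))) ⟶ diag (.of ℂ) G :=
  charPoint χ ≫ diagMap (.of ℂ) ((MonoidHom.snd _ F).comp e.toMonoidHom)

theorem finitePoint_mul (χ ψ : F →* ℂˣ) :
    finitePoint e (χ * ψ) = finitePoint e χ * finitePoint e ψ := by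
  rw [finitePoint, charPoint_mul, MonObj.mul_comp]
  rfl

theorem finitePoint_one : finitePoint e 1 = 1 := by
  rw [finitePoint, charPoint_one, MonObj.one_comp]

/-- The translate of the torus by a character of `F`. -/
def twistPoint (χ : F →* ℂˣ) : torus r ⟶ diag (.of ℂ) G := point (twist e χ)

theorem point_of (N : Type) [CommMonoid N] :
    point (k := ℂ) (MonoidAlgebra.of ℂ N) = 𝟙 (diag (.of ℂ) N) := by
  apply Over.OverMorphism.ext
  rw [point_left]
  refine Eq.trans (congrArg (fun t => Spec.map (CommRingCat.ofHom t)) ?_) (Spec.map_id _)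
  apply MonoidAlgebra.ringHom_ext
  · intro c
    simp
  · intro n
    simp

theorem twistPoint_eq (χ : F →* ℂˣ) :
    twistPoint e χ = torusHom e * (toUnit _ ≫ finitePoint e χ) := by
  refine (point_mul _ _).trans (congrArg₂ (· * ·) ?_ ?_)
  · refine (point_diagMap _ _).symm.trans ?_
    exact (congrArg (· ≫ torusHom e) (point_of _)).trans (Category.id_comp _)
  · refine (toUnit_basePoint (T := MonoidAlgebra ℂ (Multiplicative (Fin r → ℤ))) _).symm.trans ?_
    exact congrArg (toUnit _ ≫ ·) (basePoint_diagMap _ _).symm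

end TwistPoint

/-! ### Cells and the components they generate -/

section Cell

variable {G F : Type} [CommMonoid G] [CommGroup F] {r : ℕ}
  (e : G ≃* Multiplicative (Fin r → ℤ) × F) {Y : Over (Spec (CommRingCat.of ℂ))}
  (j : diag (.of ℂ) G ⟶ Y)

/-- The inclusion of a translate of the torus into `Y`. -/
def cell (χ : F →* ℂˣ) : torus r ⟶ Y := twistPoint e χ ≫ j

theorem isOpen_range_cell [Finite F] [IsOpenImmersion j.left] (χ : F →* ℂˣ) :
    IsOpen (Set.range (cell e j χ).left) := by
  have h : Set.range (cell e j χ).left = j.left '' (Set.range (twistPoint e χ).left) :=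
    Set.range_comp j.left (twistPoint e χ).left
  rw [h]
  refine j.left.isOpenEmbedding.isOpenMap _ ?_
  exact isOpen_range_comap_twistHom e χ

instance (r : ℕ) : AlgebraicGeometry.IsIntegral (torus r).left :=
  inferInstanceAs (AlgebraicGeometry.IsIntegral
    (Spec (CommRingCat.of (MonoidAlgebra ℂ (Multiplicative (Fin r → ℤ))))))

theorem isIrreducible_range_cell (χ : F →* ℂˣ) : IsIrreducible (Set.range (cell e j χ).left) := by
  rw [← Set.image_univ]
  exact (IrreducibleSpace.isIrreducible_univ _).image _ (cell e j χ).left.continuous.continuousOn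

theorem dense_iUnion_range_cell [Finite F] (hj : DenseRange j.left) :
    Dense (⋃ χ, Set.range (cell e j χ).left) := by
  refine hj.mono ?_
  rintro _ ⟨P, rfl⟩
  obtain ⟨χ, Q, hQ⟩ := exists_mem_range e P
  exact Set.mem_iUnion.mpr ⟨χ, Q, congrArg j.left hQ⟩

theorem exists_eq_closure_range_cell [Finite F] (hj : DenseRange j.left)
    (Z : irreducibleComponents Y.left) :
    ∃ χ, Z.1 = closure (Set.range (cell e j χ).left) :=
  exists_eq_closure_of_mem_irreducibleComponents _ (isIrreducible_range_cell e j)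
    (dense_iUnion_range_cell e j hj) Z.2

variable (a : ModObj (diag (.of ℂ) G) Y)

variable {e j a} in
theorem smul_comp_of_whiskerLeft (h : diag (.of ℂ) G ◁ j ≫ a.smul = MonObj.mul ≫ j)
    {W : Over (Spec (CommRingCat.of ℂ))} (m n : W ⟶ diag (.of ℂ) G) :
    m • (n ≫ j) = (m * n) ≫ j := by
  rw [Hom.smul_def, Hom.mul_def, Category.assoc, ← h, lift_whiskerLeft_assoc]

/-- On the image of `j` the action is multiplication, so translating by a character multiplies the
character that labels the cell. -/
theorem cell_comp_translation (h : diag (.of ℂ) G ◁ j ≫ a.smul = MonObj.mul ≫ j)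
    (χ ψ : F →* ℂˣ) :
    cell e j χ ≫ translation a (finitePoint e ψ) = cell e j (ψ * χ) := by
  rw [comp_translation, cell, smul_comp_of_whiskerLeft h, cell, twistPoint_eq, twistPoint_eq,
    finitePoint_mul, MonObj.comp_mul, mul_left_comm]

theorem range_componentι_comp_translation_subset
    (h : diag (.of ℂ) G ◁ j ≫ a.smul = MonObj.mul ≫ j)
    {Z Z' : irreducibleComponents Y.left} {χ ψ : F →* ℂˣ}
    (hZ : Z.1 = closure (Set.range (cell e j χ).left))
    (hZ' : Z'.1 = closure (Set.range (cell e j (ψ * χ)).left)) :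
    Set.range (componentι Z ≫ translation a (finitePoint e ψ)).left ⊆ Z'.1 := by
  have h1 : Set.range (componentι Z ≫ translation a (finitePoint e ψ)).left =
      (translation a (finitePoint e ψ)).left '' Z.1 := by
    rw [← range_componentι_left Z]
    exact Set.range_comp (translation a (finitePoint e ψ)).left (componentι Z).left
  have h2 : Set.range (cell e j (ψ * χ)).left =
      (translation a (finitePoint e ψ)).left '' Set.range (cell e j χ).left := by
    rw [← cell_comp_translation e j a h]
    exact Set.range_comp (translation a (finitePoint e ψ)).left (cell e j χ).left
  rw [h1, hZ, hZ', h2]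
  exact image_closure_subset_closure_image (translation a (finitePoint e ψ)).left.continuous

theorem exists_hom_component (h : diag (.of ℂ) G ◁ j ≫ a.smul = MonObj.mul ≫ j)
    {Z Z' : irreducibleComponents Y.left} {χ ψ : F →* ℂˣ}
    (hZ : Z.1 = closure (Set.range (cell e j χ).left))
    (hZ' : Z'.1 = closure (Set.range (cell e j (ψ * χ)).left)) :
    ∃ f : component Z ⟶ component Z',
      f ≫ componentι Z' = componentι Z ≫ translation a (finitePoint e ψ) :=
  exists_comp_componentι_eq Z' _ (range_componentι_comp_translation_subset e j a h hZ hZ')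

theorem exists_iso_component (h : diag (.of ℂ) G ◁ j ≫ a.smul = MonObj.mul ≫ j)
    {Z Z' : irreducibleComponents Y.left} {χ ψ : F →* ℂˣ}
    (hZ : Z.1 = closure (Set.range (cell e j χ).left))
    (hZ' : Z'.1 = closure (Set.range (cell e j (ψ * χ)).left)) :
    ∃ f : component Z ≅ component Z',
      f.hom ≫ componentι Z' = componentι Z ≫ translation a (finitePoint e ψ) := by
  obtain ⟨f, hf⟩ := exists_hom_component e j a h hZ hZ'
  -- Translation by `ψ⁻¹` supplies the inverse; the composites are identities after the monic
  -- inclusions.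
  obtain ⟨g, hg⟩ := exists_hom_component e j a h (ψ := ψ⁻¹) hZ' (by
    rw [show ψ⁻¹ * (ψ * χ) = χ from inv_mul_cancel_left ψ χ, hZ])
  refine ⟨⟨f, g, ?_, ?_⟩, hf⟩
  · rw [← cancel_mono (componentι Z), Category.assoc, hg, ← Category.assoc, hf, Category.assoc,
      translation_comp_translation, ← finitePoint_mul, show ψ⁻¹ * ψ = 1 from inv_mul_cancel ψ,
      finitePoint_one,
      translation_one, Category.comp_id, Category.id_comp]
  · rw [← cancel_mono (componentι Z'), Category.assoc, hf, ← Category.assoc, hg, Category.assoc,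
      translation_comp_translation, ← finitePoint_mul, show ψ * ψ⁻¹ = 1 from mul_inv_cancel ψ,
      finitePoint_one,
      translation_one, Category.comp_id, Category.id_comp]

/-- Irreducible components are stable under the action of the torus. -/
theorem range_tensorHom_smul_subset [LocallyOfFiniteType Y.hom] (Z : irreducibleComponents Y.left) :
    Set.range ((torusHom e ⊗ₘ componentι Z) ≫ a.smul).left ⊆ Z.1 := by
  set g := (torusHom e ⊗ₘ componentι Z) ≫ a.smul with hg
  have := locallyOfFiniteType_component_hom Z
  have := isIntegral_torus_tensor r (component Z)
  have hirr : IsIrreducible (Set.range g.left) := by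
    rw [← Set.image_univ]
    exact (IrreducibleSpace.isIrreducible_univ _).image _ g.left.continuous.continuousOn
  -- Acting by the unit section recovers the inclusion, so the irreducible image of `g` contains
  -- `Z`; maximality of `Z` then bounds that image.
  have h1 : lift 1 (𝟙 (component Z)) ≫ g = componentι Z := by
    rw [hg, lift_tensorHom_smul, MonObj.one_comp, one_smul, Category.id_comp]
  have hsub : Z.1 ⊆ Set.range g.left := by
    rw [← range_componentι_left Z]
    rintro _ ⟨z, rfl⟩
    exact ⟨(lift 1 (𝟙 (component Z)) : _ ⟶ torus r ⊗ component Z).left z,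
      congrArg (fun t : component Z ⟶ Y => t.left z) h1⟩
  exact Z.2.2 hirr hsub

theorem exists_modObj_component [LocallyOfFiniteType Y.hom] (Z : irreducibleComponents Y.left) :
    ∃ b : ModObj (torus r) (component Z),
      b.smul ≫ componentι Z = (torusHom e ⊗ₘ componentι Z) ≫ a.smul := by
  have := locallyOfFiniteType_component_hom Z
  have := isIntegral_torus_tensor r (component Z)
  obtain ⟨s, hs⟩ := exists_comp_componentι_eq Z _ (range_tensorHom_smul_subset e a Z)
  obtain ⟨b, hb⟩ := exists_modObj_restrict a (torusHom e) (componentι Z) s hs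
  exact ⟨b, by rw [hb, hs]⟩

variable {a}

theorem isToricVariety_component [Finite F] [IsOpenImmersion j.left] [LocallyOfFiniteType Y.hom]
    [QuasiCompact Y.hom] (h : diag (.of ℂ) G ◁ j ≫ a.smul = MonObj.mul ≫ j)
    {Z : irreducibleComponents Y.left} {χ : F →* ℂˣ}
    (hZ : Z.1 = closure (Set.range (cell e j χ).left)) (b : ModObj (torus r) (component Z))
    (hb : b.smul ≫ componentι Z = (torusHom e ⊗ₘ componentι Z) ≫ a.smul) :
    IsToricVariety b where
  isIntegral := inferInstance
  locallyOfFiniteType := locallyOfFiniteType_component_hom Z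
  quasiCompact := quasiCompact_component_hom Z
  exists_open_orbit := by
    obtain ⟨l, hl⟩ := exists_comp_componentι_eq Z (cell e j χ) (hZ ▸ subset_closure)
    -- The base point is the unit of the torus, viewed in the cell. Its orbit map is the lift `l` of
    -- the cell to `Z`, whose image is the preimage of an open subset of `Y`.
    refine ⟨1 ≫ l, ?_⟩
    have h1 : (1 : 𝟙_ _ ⟶ torus r) ≫ twistPoint e χ = finitePoint e χ := by
      rw [twistPoint_eq, MonObj.comp_mul, MonObj.one_comp, _root_.one_mul, ← Category.assoc,
        toUnit_unique ((1 : 𝟙_ _ ⟶ torus r) ≫ toUnit _) (𝟙 _), Category.id_comp]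
    have h2 : orbitMap b (1 ≫ l) = l := by
      rw [← cancel_mono (componentι Z), hl, orbitMap, Category.assoc, hb, lift_tensorHom_smul,
        Category.id_comp, Category.assoc, Category.assoc, hl, cell, ← Category.assoc 1, h1,
        ← Category.assoc, smul_comp_of_whiskerLeft h, ← twistPoint_eq]
    have h3 : Set.range l.left = (componentι Z).left ⁻¹' Set.range (cell e j χ).left := by
      rw [← hl]
      refine Eq.trans ?_ (congrArg ((componentι Z).left ⁻¹' ·)
        (Set.range_comp (componentι Z).left l.left).symm)
      exact (Set.preimage_image_eq _ (componentι Z).left.isClosedEmbedding.injective).symm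
    rw [h2, h3]
    exact (isOpen_range_cell e j χ).preimage (componentι Z).left.continuous

/-- After the monic inclusion into `Y` this says that translations commute with the torus, which
holds because `Spec ℂ[G]` is commutative. -/
theorem smul_comp_hom_eq {Z Z' : irreducibleComponents Y.left} {ψ : F →* ℂˣ}
    {f : component Z ⟶ component Z'}
    (hf : f ≫ componentι Z' = componentι Z ≫ translation a (finitePoint e ψ))
    {b : ModObj (torus r) (component Z)} {b' : ModObj (torus r) (component Z')}
    (hb : b.smul ≫ componentι Z = (torusHom e ⊗ₘ componentι Z) ≫ a.smul)
    (hb' : b'.smul ≫ componentι Z' = (torusHom e ⊗ₘ componentι Z') ≫ a.smul) :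
    b.smul ≫ f = (torus r ◁ f) ≫ b'.smul := by
  rw [← cancel_mono (componentι Z'), Category.assoc, hf, ← Category.assoc, hb,
    Category.assoc (torus r ◁ f), hb', tensorHom_smul_eq, smul_comp_translation, tensorHom_smul_eq,
    ModObj.comp_smul]
  simp [hf]

end Cell

/-- The geometric half of the argument: about `Y` it needs only finite type and a dense open
immersion of `Spec ℂ[G]` that is equivariant for multiplication. -/
theorem exists_toric_components {G F : Type} [CommMonoid G] [CommGroup F] [Finite F] {r : ℕ}
    (e : G ≃* Multiplicative (Fin r → ℤ) × F) {Y : Over (Spec (CommRingCat.of ℂ))}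
    (j : diag (.of ℂ) G ⟶ Y) [IsOpenImmersion j.left] (hj : DenseRange j.left)
    (a : ModObj (diag (.of ℂ) G) Y) (h : diag (.of ℂ) G ◁ j ≫ a.smul = MonObj.mul ≫ j)
    [LocallyOfFiniteType Y.hom] [QuasiCompact Y.hom] :
    ∃ b : ∀ Z : irreducibleComponents Y.left, ModObj (torus r) (component Z),
      (∀ Z, IsToricVariety (b Z)) ∧
      (∀ Z, (b Z).smul ≫ componentι Z =
        (diagMap (.of ℂ) ((MonoidHom.fst _ F).comp e.toMonoidHom) ⊗ₘ componentι Z) ≫ a.smul) ∧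
      ∀ Z Z' : irreducibleComponents Y.left,
        ∃ (m : 𝟙_ _ ⟶ diag (.of ℂ) F) (f : component Z ≅ component Z'),
          (b Z).smul ≫ f.hom = (torus r ◁ f.hom) ≫ (b Z').smul ∧
          f.hom ≫ componentι Z' = componentι Z ≫
            translation a (m ≫ diagMap (.of ℂ) ((MonoidHom.snd _ F).comp e.toMonoidHom)) := by
  choose b hb using exists_modObj_component e a
  choose χ hχ using exists_eq_closure_range_cell e j hj
  refine ⟨b, fun Z => isToricVariety_component e j h (hχ Z) (b Z) (hb Z), hb, fun Z Z' => ?_⟩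
  -- The quotient of the two labelling characters moves the cell of `Z` to that of `Z'`.
  obtain ⟨f, hf⟩ := exists_iso_component e j a h (ψ := χ Z' * (χ Z)⁻¹) (hχ Z)
    (by rw [show χ Z' * (χ Z)⁻¹ * χ Z = χ Z' from
      inv_mul_cancel_right (χ Z') (χ Z), hχ Z'])
  exact ⟨charPoint (χ Z' * (χ Z)⁻¹), f, smul_comp_hom_eq e hf (hb Z) (hb Z'), hf⟩

end FOne

end

open FOne
theorem theorem4p1 (X : FOne.MonoidScheme.{0}) [ConnectedSpace X.carrier]
    (hint : X.IsIntegral) (hft : X.IsOfFiniteType) :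
    ∃ η : X.carrier, IsGenericPoint η Set.univ ∧
      (∀ (U : X.AffineOpens) (h : η ∈ U.1), Function.Injective (X.toStalk U.1 η h) ∧
        ∀ g, ∃ s t, g * X.toStalk U.1 η h t = X.toStalk U.1 η h s) ∧
      ∃ a : ModObj (diag (.of ℂ) (X.stalk η)) (X.baseChange (.of ℂ)),
        X.IsCanonicalAction (.of ℂ) η a ∧
        ∃ (r : ℕ) (F : Type) (_ : CommGroup F) (_ : Finite F)
          (e : X.stalk η ≃* Multiplicative (Fin r → ℤ) × F)
          (b : ∀ Z : irreducibleComponents (X.baseChange (.of ℂ)).left,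
            ModObj (torus r) (component Z)),
          (∀ Z, IsToricVariety (b Z)) ∧
          (∀ Z, (b Z).smul ≫ componentι Z =
            (diagMap (.of ℂ) ((MonoidHom.fst _ F).comp e.toMonoidHom) ⊗ₘ componentι Z) ≫
              a.smul) ∧
          ∀ Z Z' : irreducibleComponents (X.baseChange (.of ℂ)).left,
            ∃ (m : 𝟙_ _ ⟶ diag (.of ℂ) F) (f : component Z ≅ component Z'),
              (b Z).smul ≫ f.hom = (torus r ◁ f.hom) ≫ (b Z').smul ∧
              f.hom ≫ componentι Z' = componentι Z ≫
                translation a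
                  (m ≫ diagMap (.of ℂ) ((MonoidHom.snd _ F).comp e.toMonoidHom)) := by
  obtain ⟨x, hgen, hx, U₀, hU₀⟩ := MonoidScheme.exists_genericPoint hft
  obtain ⟨a, ha⟩ := MonoidScheme.exists_isCanonicalAction (.of ℂ) hx
  obtain ⟨n, U, hU, hcov⟩ := hft.exists_cover
  -- Any member of the covering will do; `U₀` serves only to show that there is one. Its finitely
  -- generated sections have the stalk as their fractions.
  obtain ⟨i, -⟩ := hcov U₀
  have := hU i
  obtain ⟨r, F, hF, hfin, ⟨e⟩⟩ := exists_mulEquiv_of_fraction (MonoidScheme.isUnit_stalk hU₀)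
    (X.toStalk (U i).1 x (hx (U i))) (MonoidScheme.exists_mul_toStalk_eq hU₀ (U i) (hx (U i)))
  obtain ⟨hlft, hqc⟩ := MonoidScheme.baseChange_finiteType (.of ℂ) hft
  have := MonoidScheme.isOpenImmersion_stalkChart_left (.of ℂ) hU₀ (hx U₀)
  exact ⟨x, hgen, fun U h => ⟨MonoidScheme.toStalk_injective hint hU₀ U h,
    MonoidScheme.exists_mul_toStalk_eq hU₀ U h⟩, a, ha, r, F, hF, hfin, e,
    exists_toric_components e (X.stalkChart (.of ℂ) U₀ (hx U₀))
      (MonoidScheme.denseRange_stalkChart_left (.of ℂ) hint hU₀ hx) a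
      (MonoidScheme.whiskerLeft_stalkChart (.of ℂ) ha U₀ (hx U₀))⟩
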